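/- **Definitions.** Let $\Delta^n$ be the standard $n$-simplex. For a topological space $X$, let $C_n(X)$ be the free abelian group on the continuous maps $\sigma:\Delta^n\to X$ (singular simplices), with the usual boundary $\partial$. A face of $\sigma$ is the restriction of $\sigma$ to a face of $\Delta^n$ (possibly $\Delta^n$ itself), and $b(\cdot)$ denotes the image of the barycenter of the (face of the) standard simplex. A *nesting* $\eta$ on $X$ assigns to each finite (possibly empty) sequence of points of $X$ an open subset of $X$ such that (i) $\eta(\emptyset)=X$; (ii) if $n\ge 1$ and $x_1\in\eta(x_2,\dots,x_n)$, then $x_1\in\eta(x_1,\dots,x_n)$; (iii) $\eta(x_1,\dots,x_n)\subset\eta(x_{f(1)},\dots,x_{f(m)})$ for every nondecreasing $f:\{1,\dots,m\}\to\{1,\dots,n\}$. Let $C_n^\eta(X)\subset C_n(X)$ be the free abelian group on those $\sigma:\Delta^n\to X$ such that for every chain of faces $\sigma_1\subset\cdots\subset\sigma_m\subset\sigma$ with $m\ge1$ the image of $\sigma_1$ is contained in $\eta(b(\sigma_1),\dots,b(\sigma_m))$. These groups form a subcomplex $C_\bullet^\eta(X)$ of $C_\bullet(X)$; let $i$ denote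 the inclusion. Let $A_\bullet(\Delta^k)$ be the simplicial chain complex of $\Delta^k$: $A_n(\Delta^k)$ is the free abelian group on the $n$-dimensional faces of $\Delta^k$, and it is embedded in $C_n(\Delta^k)$ by regarding each face, with its vertices in their natural order, as an affine singular simplex. **Proposition.** (a) Let $k\ge0$ and let $\eta$ be a nesting on $\Delta^k$. Then there exist a map of complexes $\pi:A_\bullet(\Delta^k)\to C_\bullet^\eta(\Delta^k)$ and a chain homotopy $h:A_n(\Delta^k)\to C_{n+1}(\Delta^k)$, $n\ge0$, between $i\circ\pi$ and the natural embedding $A_\bullet(\Delta^k)\to C_\bullet(\Delta^k)$, that is, $\partial h(a)+h(\partial a)=a-\pi(a)$, such that $h$ maps $A_n(\Delta^k)\cap C_n^\eta(\Delta^k)$ into $C_{n+1}^\eta(\Delta^k)$ for every $n\ge0$. (b) Let $X$ be any topological space, $\eta$ a nesting on $X$ and $n\ge0$. If a chain $c\in C_n^\eta(X)$ is the boundary of a chain in $C_{n+1}(X)$, then it is the boundary of a chain in $C_{n+1}^\eta(X)$. -/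

import Mathlib

open CategoryTheory

universe u

/-- A nesting on `X`: an open subset `η x` for every finite (possibly empty) sequence `x` in `X`,
such that the open set of the empty sequence is `X`; if `x₁ ∈ η (x₂, …, xₙ)` then
`η (x₁, …, xₙ)` is a neighbourhood of `x₁`; and
`η (x₁, …, xₙ) ⊆ η (x_{f 1}, …, x_{f m})` for every nondecreasing `f`. -/
structure Nesting (X : Type u) [TopologicalSpace X] where
  toOpens : ∀ {n : ℕ}, (Fin n → X) → TopologicalSpace.Opens X
  nil_eq_top : ∀ x : Fin 0 → X, toOpens x = ⊤
  mem_of_mem_tail : ∀ {n : ℕ} (x : Fin (n + 1) → X),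
    x 0 ∈ toOpens (Fin.tail x) → x 0 ∈ toOpens x
  le_comp : ∀ {m n : ℕ} (f : Fin m → Fin n), Monotone f → ∀ x : Fin n → X,
    toOpens x ≤ toOpens (x ∘ f)

theorem Fin.succAbove_comp_succAbove {n : ℕ} (i j : Fin (n + 2)) (hij : i ≤ j) (l : Fin (n + 1)) :
    j.succ.succAbove (i.succAbove l) = i.castSucc.succAbove (j.succAbove l) := by
  simp only [Fin.succAbove, Fin.lt_def, Fin.le_def, Fin.ext_iff] at *
  split_ifs <;> simp_all <;> lia

/-- A family of sets of simplices, one for each dimension, with face maps `d i` satisfying the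
simplicial identities (a semisimplicial set). -/
structure FaceSystem where
  obj : ℕ → Type u
  face : ∀ {n : ℕ}, Fin (n + 2) → obj (n + 1) → obj n
  face_face : ∀ {n : ℕ} (i j : Fin (n + 2)), i ≤ j → ∀ x : obj (n + 2),
    face i (face j.succ x) = face j (face i.castSucc x)

namespace FaceSystem

noncomputable section

variable (S : FaceSystem.{u})

/-- The boundary `∂ x = ∑ i, (-1) ^ i • d i x` on free abelian groups. -/
def boundary (n : ℕ) : (S.obj (n + 1) →₀ ℤ) →ₗ[ℤ] (S.obj n →₀ ℤ) :=
  ∑ i : Fin (n + 2), (-1 : ℤ) ^ (i : ℕ) • Finsupp.lmapDomain ℤ ℤ (S.face i)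

theorem boundary_single (n : ℕ) (x : S.obj (n + 1)) (a : ℤ) :
    S.boundary n (Finsupp.single x a) =
      ∑ i : Fin (n + 2), (-1 : ℤ) ^ (i : ℕ) • Finsupp.single (S.face i x) a := by
  simp [boundary, LinearMap.sum_apply, Finsupp.mapDomain_single]

theorem boundary_comp_boundary (n : ℕ) : S.boundary n ∘ₗ S.boundary (n + 1) = 0 := by
  refine Finsupp.lhom_ext fun x a => ?_
  simp only [LinearMap.comp_apply, boundary_single, map_sum, map_smul, LinearMap.zero_apply,
    Finset.smul_sum, smul_smul]
  rw [Finset.sum_comm, ← Finset.sum_product', Finset.univ_product_univ,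
    ← Finset.sum_add_sum_compl
      ({ij | (ij.2 : ℕ) ≤ (ij.1 : ℕ)} : Finset (Fin (n + 2) × Fin (n + 3))),
    ← eq_neg_iff_add_eq_zero, ← Finset.sum_neg_distrib]
  refine Finset.sum_bij
    (fun ij hij => (Fin.castLT ij.2 (lt_of_le_of_lt (Finset.mem_filter.mp hij).right ij.1.is_lt),
      ij.1.succ)) ?_ ?_ ?_ ?_
  · intro ij hij
    simp only [Finset.compl_filter, Finset.mem_filter_univ, Fin.val_succ, Fin.val_castLT]
      at hij ⊢
    lia
  · rintro ⟨i, j⟩ hij ⟨i', j'⟩ hij' h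
    simp only [Prod.mk_inj, Fin.succ_inj] at h
    ext
    · simp [h.2]
    · simpa using congrArg Fin.val h.1
  · rintro ⟨i', j'⟩ hij'
    simp only [Finset.compl_filter, Finset.mem_filter_univ, not_le] at hij'
    refine ⟨(j'.pred ?_, Fin.castSucc i'), ?_, ?_⟩
    · rintro rfl
      simp at hij'
    · simpa using Nat.le_sub_one_of_lt hij'
    · simp
  · rintro ⟨i, j⟩ hij
    simp only [Finset.mem_filter_univ] at hij
    have hlt : (j : ℕ) < n + 2 := lt_of_le_of_lt hij i.is_lt
    have key := S.face_face (Fin.castLT j hlt) i (Fin.le_def.2 (by simpa using hij)) x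
    rw [Fin.castSucc_castLT] at key
    simp only [key, Fin.val_succ, Fin.val_castLT, ← neg_smul]
    congr 1
    ring

/-- The chain complex of free abelian groups on the simplices of `S`. -/
def chains : ChainComplex (ModuleCat.{u} ℤ) ℕ :=
  ChainComplex.of (fun n => ModuleCat.of ℤ (S.obj n →₀ ℤ)) (fun n => ModuleCat.ofHom (S.boundary n))
    (fun n => by
      rw [← ModuleCat.ofHom_comp, boundary_comp_boundary]
      rfl)

theorem chains_d (n : ℕ) : S.chains.d (n + 1) n = ModuleCat.ofHom (S.boundary n) :=
  ChainComplex.of_d (fun n => ModuleCat.of ℤ (S.obj n →₀ ℤ)) (fun n => ModuleCat.ofHom (S.boundary n)) n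

/-- The map of complexes induced by maps of simplices that commute with the face maps. -/
def chainsMap {S T : FaceSystem.{u}} (φ : ∀ n : ℕ, S.obj n → T.obj n)
    (hφ : ∀ (n : ℕ) (i : Fin (n + 2)) (x : S.obj (n + 1)),
      φ n (S.face i x) = T.face i (φ (n + 1) x)) :
    S.chains ⟶ T.chains :=
  ChainComplex.ofHom (X := S.chains) (Y := T.chains)
    (fun n => ModuleCat.ofHom (Finsupp.lmapDomain ℤ ℤ (φ n)))
    (fun n => by
      rw [chains_d, chains_d]
      change ModuleCat.ofHom _ ≫ ModuleCat.ofHom _ = ModuleCat.ofHom _ ≫ ModuleCat.ofHom _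
      rw [← ModuleCat.ofHom_comp, ← ModuleCat.ofHom_comp]
      congr 1
      refine Finsupp.lhom_ext fun x a => ?_
      simp only [LinearMap.comp_apply, Finsupp.lmapDomain_apply, Finsupp.mapDomain_single,
        boundary_single, Finsupp.mapDomain_finsetSum, Finsupp.mapDomain_smul, hφ])

end

end FaceSystem

noncomputable section

/-- The affine map `Δ^m → Δ^n` induced by a map of the vertices. -/
def simplexMap {m n : ℕ} (f : Fin (m + 1) → Fin (n + 1)) :
    C(stdSimplex ℝ (Fin (m + 1)), stdSimplex ℝ (Fin (n + 1))) :=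
  ⟨stdSimplex.map f, stdSimplex.continuous_map f⟩

theorem simplexMap_comp {l m n : ℕ} (g : Fin (m + 1) → Fin (n + 1))
    (f : Fin (l + 1) → Fin (m + 1)) :
    (simplexMap g).comp (simplexMap f) = simplexMap (g ∘ f) := by
  ext1 p
  exact stdSimplex.map_comp_apply f g p

theorem simplexMap_apply {m n : ℕ} (f : Fin (m + 1) → Fin (n + 1))
    (p : stdSimplex ℝ (Fin (m + 1))) (j : Fin (n + 1)) :
    simplexMap f p j = ∑ i with f i = j, p i :=
  FunOnFinite.linearMap_apply_apply ℝ ℝ f p j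

/-- The singular simplices of `X`; the `i`-th face is the restriction to the face of the standard
simplex opposite to the `i`-th vertex. -/
def singularSimplices (X : Type u) [TopologicalSpace X] : FaceSystem.{u} where
  obj n := C(stdSimplex ℝ (Fin (n + 1)), X)
  face i σ := σ.comp (simplexMap i.succAbove)
  face_face i j hij σ := by
    simp only [ContinuousMap.comp_assoc, simplexMap_comp]
    congr 2
    funext l
    exact Fin.succAbove_comp_succAbove i j hij l

/-- The faces of `Δ^n`, as nonempty sets of vertices ordered by inclusion. -/
abbrev SimplexFace (n : ℕ) : Type := {T : Finset (Fin (n + 1)) // T.Nonempty}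

namespace SimplexFace

/-- The points of a face. -/
def points {n : ℕ} (T : SimplexFace n) : Set (stdSimplex ℝ (Fin (n + 1))) :=
  {p | ∀ i ∉ T.1, p i = 0}

/-- The barycenter of a face. -/
def barycenter {n : ℕ} (T : SimplexFace n) : stdSimplex ℝ (Fin (n + 1)) :=
  ⟨fun i => if i ∈ T.1 then (T.1.card : ℝ)⁻¹ else 0, fun i => by positivity, by
    have h : (T.1.card : ℝ) ≠ 0 := by exact_mod_cast T.2.card_pos.ne'
    simp [h]⟩

end SimplexFace

/-- For every chain of faces `σ₁ ⊆ ⋯ ⊆ σₘ` of `σ`, `m ≥ 1`, the face `σ₁` is contained in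
`η (b σ₁, …, b σₘ)`. -/
def Nesting.IsNested {X : Type u} [TopologicalSpace X] (η : Nesting X) {n : ℕ}
    (σ : C(stdSimplex ℝ (Fin (n + 1)), X)) : Prop :=
  ∀ (m : ℕ) (T : Fin (m + 1) → SimplexFace n), Monotone T →
    σ '' (T 0).points ⊆ η.toOpens fun i => σ (T i).barycenter

/-- The image of a face under an injection of vertices. -/
def SimplexFace.map {m n : ℕ} (f : Fin (m + 1) ↪ Fin (n + 1)) (T : SimplexFace m) :
    SimplexFace n :=
  ⟨T.1.map f, T.2.map⟩

theorem SimplexFace.simplexMap_mem_points {m n : ℕ} (f : Fin (m + 1) ↪ Fin (n + 1))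
    (T : SimplexFace m) {p : stdSimplex ℝ (Fin (m + 1))} (hp : p ∈ T.points) :
    simplexMap f p ∈ (T.map f).points := by
  intro j hj
  rw [simplexMap_apply]
  refine Finset.sum_eq_zero fun i hi => hp i fun hiT => hj ?_
  exact Finset.mem_map.2 ⟨i, hiT, (Finset.mem_filter.1 hi).2⟩

theorem SimplexFace.simplexMap_barycenter {m n : ℕ} (f : Fin (m + 1) ↪ Fin (n + 1))
    (T : SimplexFace m) : simplexMap f T.barycenter = (T.map f).barycenter := by
  refine stdSimplex.ext (funext fun j => ?_)
  rw [simplexMap_apply]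
  change ∑ i with f i = j, (if i ∈ T.1 then (T.1.card : ℝ)⁻¹ else 0) =
    if j ∈ T.1.map f then ((T.1.map f).card : ℝ)⁻¹ else 0
  rw [Finset.card_map]
  by_cases hj : ∃ i, f i = j
  · obtain ⟨i, rfl⟩ := hj
    rw [Finset.sum_eq_single i]
    · simp
    · intro b hb hne
      exact absurd (f.injective (Finset.mem_filter.1 hb).2) hne
    · simp
  · push Not at hj
    rw [Finset.sum_eq_zero fun i hi => absurd (Finset.mem_filter.1 hi).2 (hj i), if_neg]
    intro h
    obtain ⟨i, -, hi⟩ := Finset.mem_map.1 h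
    exact hj i hi

theorem Nesting.IsNested.comp_simplexMap {X : Type u} [TopologicalSpace X] {η : Nesting X}
    {m n : ℕ} {σ : C(stdSimplex ℝ (Fin (n + 1)), X)} (hσ : η.IsNested σ)
    (f : Fin (m + 1) ↪ Fin (n + 1)) : η.IsNested (σ.comp (simplexMap f)) := by
  rintro l T hT _ ⟨p, hp, rfl⟩
  have h := hσ l (fun i => (T i).map f)
    (fun i j hij => Finset.map_subset_map.2 (hT hij))
    ⟨simplexMap f p, SimplexFace.simplexMap_mem_points f _ hp, rfl⟩
  simpa only [ContinuousMap.comp_apply, SimplexFace.simplexMap_barycenter] using h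

/-- The singular simplices that satisfy the nesting condition of `η`. -/
def nestedSimplices {X : Type u} [TopologicalSpace X] (η : Nesting X) : FaceSystem.{u} where
  obj n := {σ : C(stdSimplex ℝ (Fin (n + 1)), X) // η.IsNested σ}
  face i σ := ⟨σ.1.comp (simplexMap i.succAbove), σ.2.comp_simplexMap i.succAboveEmb⟩
  face_face i j hij σ := Subtype.ext ((singularSimplices X).face_face i j hij σ.1)

/-- The faces of `Δ^k` as an ordered simplicial complex: an `n`-face is listed by its vertices in
increasing order, and the `i`-th face omits the `i`-th vertex. -/
def simplexFaces (k : ℕ) : FaceSystem.{0} where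
  obj n := Fin (n + 1) ↪o Fin (k + 1)
  face i τ := i.succAboveOrderEmb.trans τ
  face_face i j hij τ := by
    ext l
    exact congrArg (fun a => (τ a : ℕ)) (Fin.succAbove_comp_succAbove i j hij l)

/-- The singular chain complex `C_•(X)`. -/
def singularChains (X : Type u) [TopologicalSpace X] : ChainComplex (ModuleCat.{u} ℤ) ℕ :=
  (singularSimplices X).chains

/-- The complex `C_•^η(X)`. -/
def nestedChains {X : Type u} [TopologicalSpace X] (η : Nesting X) :
    ChainComplex (ModuleCat.{u} ℤ) ℕ :=
  (nestedSimplices η).chains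

/-- The inclusion `C_•^η(X) → C_•(X)`. -/
def nestedInclusion {X : Type u} [TopologicalSpace X] (η : Nesting X) :
    nestedChains η ⟶ singularChains X :=
  FaceSystem.chainsMap (S := nestedSimplices η) (T := singularSimplices X)
    (fun _ σ => σ.1) (fun _ _ _ => rfl)

/-- The simplicial chain complex `A_•(Δ^k)`. -/
def simplicialChains (k : ℕ) : ChainComplex (ModuleCat.{0} ℤ) ℕ :=
  (simplexFaces k).chains

/-- The natural embedding `A_•(Δ^k) → C_•(Δ^k)`, sending a face with vertices `v₀ < ⋯ < vₙ` to the
affine singular simplex with these vertices. -/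
def simplicialEmbedding (k : ℕ) :
    simplicialChains k ⟶ singularChains (stdSimplex ℝ (Fin (k + 1))) :=
  FaceSystem.chainsMap (S := simplexFaces k)
    (T := singularSimplices (stdSimplex ℝ (Fin (k + 1))))
    (fun n (τ : Fin (n + 1) ↪o Fin (k + 1)) => simplexMap τ)
    (fun n i (τ : Fin (n + 2) ↪o Fin (k + 1)) => (simplexMap_comp τ i.succAbove).symm)

end

/-!
Nested chains are a homotopically full part of the singular chains because cones can be made nested.
Let `ζ_p` be the partial nesting `(x₁, …, xₙ) ↦ ζ (x₁, …, xₙ, p)`, whose domain is `ζ (p)`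
(`PartialNesting.adjoin`). If the cone with apex `p` over a simplex lies in `ζ (p)` and the simplex
is `ζ_p`-nested, then the cone is `ζ`-nested, provided it is parametrized so that the barycenter of
every face containing the apex goes to `p` (`PartialNesting.IsNested.coneMap`). Moreover a
`ζ`-nested simplex `σ` lies in `ζ (b σ)` and is `ζ_{b σ}`-nested, since a chain of faces of `σ` can
be prolonged by `σ` itself (`PartialNesting.IsNested.adjoin_bary`).

The operators to be constructed have the form `h σ = σ_* (h' σ)` with `h' σ` a chain in the standard
simplex (`transport`), and `1 - ∂h - h∂` is then automatically a chain map (`deform`). For a finite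
set `S` of partial nestings and a finite set `F` of simplices closed under faces, `h'` is called
adapted (`Adapted`) if for every `ζ ∈ S` and `σ ∈ F`, the chain `h σ` is `ζ`-nested when `σ` is, and
the image of `σ` under `1 - ∂h - h∂` is `ζ`-nested when `σ` lies in the domain of `ζ`. Both
assertions of the theorem follow at once from the existence of adapted operators (`hasAdapted`),
which is proved by induction on the dimension, alternating between two steps.

* From adapted operators in dimensions `≤ n`, one gets that for a nesting `η` of `Δ^{n+1}`, a nested
  `n`-chain `∂z` is the boundary of a nested chain (`fillsBoundaries_of_hasAdapted`). Barycentric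
  subdivision replaces `z` by a chain with the same boundary whose simplices `σ` either lie in a ball
  contained in `η (x)` about its center `x`, or factor through a nested simplex `τ` of the boundary
  and hence lie in `η (x)` for `x = b τ` (`exists_refinement`). Operators adapted to `η` and to all
  the `η_x` replace `∂σ` by an `η_x`-nested cycle, which is then filled by the cone with apex `x`.
* To pass to dimension `n + 1` (`hasAdapted_succ`), take operators in dimensions `≤ n` that are also
  adapted to `ζ_{b σ}`, for `ζ ∈ S` and the `(n + 1)`-simplices `σ ∈ F`. Working in `Δ^{n+1}`, put
  `z = ι - h∂ι`, where `ι` is the identity simplex. Its boundary is nested for all relevant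
  conditions, hence by the first step it is also the boundary of a chain `x` nested for them. The
  cone over the cycle `z - x` from the barycenter is the required value of `h'`.

Only finitely many conditions can be imposed at a time, because intersections of infinitely many
open sets need not be open; this is why `S` and `F` are finite and `S` varies in the induction.
-/

universe v w

noncomputable section

/-! ### Singular chains and operators on them -/

/-- The standard simplex `Δ^n`. -/
abbrev StdSpx (n : ℕ) : Type := stdSimplex ℝ (Fin (n + 1))

/-- The group `C_n(X)` of singular chains, as a plain abelian group. -/
abbrev SChain (X : Type u) [TopologicalSpace X] (n : ℕ) : Type u := C(StdSpx n, X) →₀ ℤ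

section chains

variable {X : Type u} {Y : Type v} {Z : Type w} [TopologicalSpace X] [TopologicalSpace Y]
  [TopologicalSpace Z]

/-- The singular boundary. -/
def bdry (n : ℕ) : SChain X (n + 1) →ₗ[ℤ] SChain X n := (singularSimplices X).boundary n

theorem bdry_single (n : ℕ) (σ : C(StdSpx (n + 1), X)) (a : ℤ) :
    bdry n (Finsupp.single σ a) =
      ∑ i : Fin (n + 2), (-1 : ℤ) ^ (i : ℕ) •
        Finsupp.single (σ.comp (simplexMap i.succAbove)) a :=
  (singularSimplices X).boundary_single n σ a

@[simp] theorem bdry_bdry (n : ℕ) (c : SChain X (n + 2)) : bdry n (bdry (n + 1) c) = 0 :=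
  LinearMap.congr_fun ((singularSimplices X).boundary_comp_boundary n) c

/-- The map on chains induced by a continuous map. -/
def push (g : C(X, Y)) (n : ℕ) : SChain X n →ₗ[ℤ] SChain Y n :=
  Finsupp.lmapDomain ℤ ℤ fun σ => g.comp σ

@[simp] theorem push_single (g : C(X, Y)) (n : ℕ) (σ : C(StdSpx n, X)) (a : ℤ) :
    push g n (Finsupp.single σ a) = Finsupp.single (g.comp σ) a := by
  simp [push]

theorem push_id (n : ℕ) (c : SChain X n) : push (ContinuousMap.id X) n c = c := by
  simp only [push, ContinuousMap.id_comp]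
  exact Finsupp.mapDomain_id

theorem push_push (g : C(Y, Z)) (f : C(X, Y)) (n : ℕ) (c : SChain X n) :
    push g n (push f n c) = push (g.comp f) n c := by
  induction c using Finsupp.induction_linear with
  | zero => simp
  | add c d hc hd => simp only [map_add, hc, hd]
  | single σ a => simp [ContinuousMap.comp_assoc]

theorem bdry_push (g : C(X, Y)) (n : ℕ) (c : SChain X (n + 1)) :
    bdry n (push g (n + 1) c) = push g n (bdry n c) := by
  induction c using Finsupp.induction_linear with
  | zero => simp
  | add c d hc hd => simp only [map_add, hc, hd]
  | single σ a =>
    simp only [push_single, bdry_single, map_sum, map_smul, ContinuousMap.comp_assoc]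

/-- The fundamental chain of `Δ^n`, given by the identity map. -/
def fund (n : ℕ) : SChain (StdSpx n) n := Finsupp.single (ContinuousMap.id _) 1

@[simp] theorem push_fund (n : ℕ) (σ : C(StdSpx n, X)) :
    push σ n (fund n) = Finsupp.single σ 1 := by
  simp [fund]

/-- To send chains supported in `s` into a subgroup, a linear map only has to do so on the
simplices in `s`. -/
theorem map_mem_of_mem_supported {α : Type*} {M : Type*} [AddCommGroup M] {s : Set α}
    (f : (α →₀ ℤ) →ₗ[ℤ] M) (N : Submodule ℤ M) (h : ∀ a ∈ s, f (Finsupp.single a 1) ∈ N)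
    {c : α →₀ ℤ} (hc : c ∈ Finsupp.supported ℤ ℤ s) : f c ∈ N := by
  rw [Finsupp.supported_eq_span_single] at hc
  induction hc using Submodule.span_induction with
  | mem x hx =>
    obtain ⟨a, ha, rfl⟩ := hx
    exact h a ha
  | zero => simp
  | add x y _ _ hx hy => simpa using add_mem hx hy
  | smul r x _ hx => simpa using N.smul_mem r hx

theorem push_mem_supported (g : C(X, Y)) (n : ℕ) {s : Set C(StdSpx n, X)} {t : Set C(StdSpx n, Y)}
    (h : ∀ σ ∈ s, g.comp σ ∈ t) {c : SChain X n} (hc : c ∈ Finsupp.supported ℤ ℤ s) :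
    push g n c ∈ Finsupp.supported ℤ ℤ t := by
  refine map_mem_of_mem_supported _ _ (fun σ hσ => ?_) hc
  rw [push_single]
  exact Finsupp.single_mem_supported ℤ _ (h σ hσ)

theorem bdry_mem_supported (n : ℕ) {s : Set C(StdSpx (n + 1), X)} {t : Set C(StdSpx n, X)}
    (h : ∀ σ ∈ s, ∀ i : Fin (n + 2), σ.comp (simplexMap i.succAbove) ∈ t) {c : SChain X (n + 1)}
    (hc : c ∈ Finsupp.supported ℤ ℤ s) : bdry n c ∈ Finsupp.supported ℤ ℤ t := by
  refine map_mem_of_mem_supported _ _ (fun σ hσ => ?_) hc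
  rw [bdry_single]
  exact sum_mem fun i _ => Submodule.smul_mem _ _ (Finsupp.single_mem_supported ℤ _ (h σ hσ i))

/-- The operator `C_n(Y) → C_{n+1}(Y)` determined by prescribing, for every simplex `τ` of `Y`, a
chain in `Δ^n` that depends only on the image of `τ` under a reference map `g : Y → X`; the chain
is transported to `Y` by `τ`. -/
def transport {n : ℕ} (h : C(StdSpx n, X) → SChain (StdSpx n) (n + 1)) (g : C(Y, X)) :
    SChain Y n →ₗ[ℤ] SChain Y (n + 1) :=
  Finsupp.linearCombination ℤ fun τ => push τ (n + 1) (h (g.comp τ))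

@[simp] theorem transport_single {n : ℕ} (h : C(StdSpx n, X) → SChain (StdSpx n) (n + 1))
    (g : C(Y, X)) (τ : C(StdSpx n, Y)) :
    transport h g (Finsupp.single τ 1) = push τ (n + 1) (h (g.comp τ)) := by
  simp [transport]

theorem push_transport {n : ℕ} (h : C(StdSpx n, X) → SChain (StdSpx n) (n + 1)) (g : C(Y, X))
    (f : C(Z, Y)) (c : SChain Z n) :
    push f (n + 1) (transport h (g.comp f) c) = transport h g (push f n c) := by
  induction c using Finsupp.induction_linear with
  | zero => simp
  | add c d hc hd => simp only [map_add, hc, hd]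
  | single σ a => simp [transport, push_push, ContinuousMap.comp_assoc]

/-- The chain map `1 - ∂h - h∂` for the operators `h` given by `transport`. -/
def deform (h : ∀ n, C(StdSpx n, X) → SChain (StdSpx n) (n + 1)) (g : C(Y, X)) :
    ∀ n, SChain Y n →ₗ[ℤ] SChain Y n
  | 0 => LinearMap.id - bdry 0 ∘ₗ transport (h 0) g
  | n + 1 => LinearMap.id - bdry (n + 1) ∘ₗ transport (h (n + 1)) g - transport (h n) g ∘ₗ bdry n

variable (h : ∀ n, C(StdSpx n, X) → SChain (StdSpx n) (n + 1)) (g : C(Y, X))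

theorem deform_zero_apply (c : SChain Y 0) :
    deform h g 0 c = c - bdry 0 (transport (h 0) g c) := rfl

theorem deform_succ_apply (n : ℕ) (c : SChain Y (n + 1)) :
    deform h g (n + 1) c =
      c - bdry (n + 1) (transport (h (n + 1)) g c) - transport (h n) g (bdry n c) := rfl

theorem deform_bdry (n : ℕ) (c : SChain Y (n + 1)) :
    deform h g n (bdry n c) = bdry n c - bdry n (transport (h n) g (bdry n c)) := by
  cases n with
  | zero => rfl
  | succ n => simp [deform_succ_apply]

theorem bdry_deform (n : ℕ) (c : SChain Y (n + 1)) :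
    bdry n (deform h g (n + 1) c) = deform h g n (bdry n c) := by
  rw [deform_bdry, deform_succ_apply]
  simp

theorem push_deform (f : C(Z, Y)) (n : ℕ) (c : SChain Z n) :
    push f n (deform h (g.comp f) n c) = deform h g n (push f n c) := by
  cases n with
  | zero => simp [deform_zero_apply, ← bdry_push, push_transport]
  | succ n =>
    rw [deform_succ_apply, deform_succ_apply, map_sub, map_sub, ← bdry_push, push_transport,
      push_transport, bdry_push]

theorem deform_congr {h h' : ∀ n, C(StdSpx n, X) → SChain (StdSpx n) (n + 1)} (g : C(Y, X))
    {n : ℕ} (H : ∀ m ≤ n, h m = h' m) : deform h g n = deform h' g n := by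
  cases n with
  | zero => simp only [deform, H 0 le_rfl]
  | succ n => simp only [deform, H (n + 1) le_rfl, H n n.le_succ]

end chains

/-! ### Cones -/

section cone

/-- The point of the face opposite to the vertex `0` on the line through this vertex and `t`; an
arbitrary point if `t` is that vertex. -/
def radial {n : ℕ} (t : StdSpx (n + 1)) : StdSpx n :=
  if h : t 0 < 1 then
    ⟨fun i => t i.succ / (1 - t 0),
      fun i => div_nonneg (stdSimplex.zero_le t _) (sub_nonneg.2 h.le), by
        have h1 := stdSimplex.sum_eq_one t
        rw [Fin.sum_univ_succ] at h1
        rw [← Finset.sum_div, div_eq_one_iff_eq (sub_pos.2 h).ne']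
        linarith⟩
  else stdSimplex.vertex 0

theorem radial_apply {n : ℕ} {t : StdSpx (n + 1)} (h : t 0 < 1) (i : Fin (n + 1)) :
    radial t i = t i.succ / (1 - t 0) := by
  rw [radial, dif_pos h]
  rfl

theorem stdSimplex_continuous_coord {n : ℕ} (j : Fin (n + 1)) :
    Continuous fun t : StdSpx n => t j :=
  (continuous_apply j).comp continuous_subtype_val

theorem continuousAt_radial {n : ℕ} {t : StdSpx (n + 1)} (h : t 0 < 1) :
    ContinuousAt (radial (n := n)) t := by
  rw [Topology.IsInducing.subtypeVal.continuousAt_iff, continuousAt_pi]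
  intro i
  have hev : ∀ᶠ s : StdSpx (n + 1) in nhds t, s 0 < 1 :=
    (stdSimplex_continuous_coord 0).continuousAt.eventually_lt_const h
  have hc : ContinuousAt (fun s : StdSpx (n + 1) => s i.succ / (1 - s 0)) t :=
    (stdSimplex_continuous_coord _).continuousAt.div
      (continuousAt_const.sub (stdSimplex_continuous_coord 0).continuousAt) (sub_pos.2 h).ne'
  refine hc.congr (hev.mono fun s hs => ?_)
  exact (radial_apply hs i).symm

/-- The weight of the apex in a cone. For `N = 0` this is the barycentric coordinate itself; in
general it is the constant `1` where the coordinate is at least `1 / (N + 1)`. -/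
def coneWeight (N : ℕ) (t : ℝ) : ℝ := min 1 ((N + 1) * t)

theorem coneWeight_le_one (N : ℕ) (t : ℝ) : coneWeight N t ≤ 1 := min_le_left _ _

theorem coneWeight_nonneg (N : ℕ) {t : ℝ} (ht : 0 ≤ t) : 0 ≤ coneWeight N t :=
  le_min zero_le_one (by positivity)

@[simp] theorem coneWeight_zero (N : ℕ) : coneWeight N 0 = 0 := by simp [coneWeight]

theorem coneWeight_one (N : ℕ) : coneWeight N 1 = 1 := by simp [coneWeight]

theorem coneWeight_of_le {N : ℕ} {t : ℝ} (h : ((N : ℝ) + 1)⁻¹ ≤ t) : coneWeight N t = 1 := by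
  have h0 : (0 : ℝ) < N + 1 := by positivity
  exact min_eq_left ((inv_le_iff_one_le_mul₀' h0).1 h)

theorem continuous_coneWeight (N : ℕ) : Continuous (coneWeight N) := by
  unfold coneWeight
  fun_prop

variable {m n : ℕ}

/-- The cone over `σ` with apex `p`: the point `t` goes to `λ p + (1 - λ) σ (radial t)`, where `λ`
is the weight of the `0`-th coordinate of `t`. The base is the face opposite to the vertex `0`. -/
def coneMap (N : ℕ) (p : StdSpx m) (σ : C(StdSpx n, StdSpx m)) : C(StdSpx (n + 1), StdSpx m) where
  toFun t := ⟨fun j => coneWeight N (t 0) * p j + (1 - coneWeight N (t 0)) * σ (radial t) j,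
    convex_stdSimplex ℝ _ p.2 (σ (radial t)).2 (coneWeight_nonneg N (stdSimplex.zero_le t 0))
      (sub_nonneg.2 (coneWeight_le_one N _)) (add_sub_cancel _ _)⟩
  continuous_toFun := by
    refine Continuous.subtype_mk (continuous_pi fun j => ?_) _
    have hw : Continuous fun t : StdSpx (n + 1) => coneWeight N (t 0) :=
      (continuous_coneWeight N).comp (stdSimplex_continuous_coord 0)
    refine (hw.mul continuous_const).add (continuous_iff_continuousAt.2 fun t => ?_)
    rcases (stdSimplex.le_one t 0).lt_or_eq with h | h
    · exact (continuous_const.sub hw).continuousAt.mul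
        (((stdSimplex_continuous_coord j).comp σ.continuous).continuousAt.comp
          (continuousAt_radial h))
    · -- at the apex, the weight of the bounded function `σ ∘ radial` tends to `0`
      have h0 : Filter.Tendsto (fun s : StdSpx (n + 1) => 1 - coneWeight N (s 0)) (nhds t)
          (nhds 0) := by
        have : Filter.Tendsto (fun s : StdSpx (n + 1) => 1 - coneWeight N (s 0)) (nhds t)
            (nhds (1 - coneWeight N (t 0))) := (continuous_const.sub hw).tendsto t
        simpa [h, coneWeight_one] using this
      have h1 : (1 - coneWeight N (t 0)) * σ (radial t) j = 0 := by simp [h, coneWeight_one]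
      rw [ContinuousAt, h1]
      refine squeeze_zero (fun s => mul_nonneg (sub_nonneg.2 (coneWeight_le_one N _))
        (stdSimplex.zero_le _ _)) (fun s => ?_) h0
      exact mul_le_of_le_one_right (sub_nonneg.2 (coneWeight_le_one N _)) (stdSimplex.le_one _ _)

theorem coneMap_apply (N : ℕ) (p : StdSpx m) (σ : C(StdSpx n, StdSpx m)) (t : StdSpx (n + 1))
    (j : Fin (m + 1)) :
    coneMap N p σ t j =
      coneWeight N (t 0) * p j + (1 - coneWeight N (t 0)) * σ (radial t) j := rfl

theorem simplexMap_apply_of_forall_ne {k l : ℕ} {f : Fin (k + 1) → Fin (l + 1)} (t : StdSpx k)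
    {j : Fin (l + 1)} (h : ∀ i, f i ≠ j) : simplexMap f t j = 0 := by
  rw [simplexMap_apply, Finset.filter_false_of_mem (fun i _ => h i), Finset.sum_empty]

theorem simplexMap_apply_of_injective {k l : ℕ} {f : Fin (k + 1) → Fin (l + 1)}
    (hf : Function.Injective f) (t : StdSpx k) (i : Fin (k + 1)) : simplexMap f t (f i) = t i := by
  rw [simplexMap_apply, Finset.sum_eq_single i]
  · intro b hb hne
    exact absurd (hf (Finset.mem_filter.1 hb).2) hne
  · simp

theorem radial_simplexMap_succ (t : StdSpx n) :
    radial (simplexMap (Fin.succ : Fin (n + 1) → Fin (n + 2)) t) = t := by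
  have h0 : simplexMap (Fin.succ : Fin (n + 1) → Fin (n + 2)) t 0 = 0 :=
    simplexMap_apply_of_forall_ne t Fin.succ_ne_zero
  refine DFunLike.ext _ _ fun i => ?_
  rw [radial_apply (by rw [h0]; exact one_pos), h0,
    simplexMap_apply_of_injective (Fin.succ_injective _)]
  simp

theorem coneMap_simplexMap_succ (N : ℕ) (p : StdSpx m) (σ : C(StdSpx n, StdSpx m))
    (t : StdSpx n) :
    coneMap N p σ (simplexMap (Fin.succ : Fin (n + 1) → Fin (n + 2)) t) = σ t := by
  refine DFunLike.ext _ _ fun j => ?_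
  rw [coneMap_apply, simplexMap_apply_of_forall_ne t Fin.succ_ne_zero, radial_simplexMap_succ]
  simp

theorem coneMap_comp_zero (N : ℕ) (p : StdSpx m) (σ : C(StdSpx n, StdSpx m)) :
    (coneMap N p σ).comp (simplexMap (0 : Fin (n + 2)).succAbove) = σ := by
  ext1 t
  rw [Fin.succAbove_zero]
  exact coneMap_simplexMap_succ N p σ t

theorem coneMap_comp_succ (N : ℕ) (p : StdSpx m) (σ : C(StdSpx (n + 1), StdSpx m))
    (i : Fin (n + 2)) :
    (coneMap N p σ).comp (simplexMap i.succ.succAbove) =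
      coneMap N p (σ.comp (simplexMap i.succAbove)) := by
  ext1 t
  refine DFunLike.ext _ _ fun j => ?_
  have h0 : simplexMap i.succ.succAbove t 0 = t 0 := by
    conv_lhs => rw [← Fin.succ_succAbove_zero i]
    exact simplexMap_apply_of_injective Fin.succAbove_right_injective t 0
  rw [ContinuousMap.comp_apply, coneMap_apply, coneMap_apply, h0, ContinuousMap.comp_apply]
  rcases (stdSimplex.le_one t 0).lt_or_eq with h | h
  · congr 4
    refine DFunLike.ext _ _ fun l => ?_
    rw [radial_apply (by rwa [h0]), h0]
    by_cases hl : ∃ a, i.succAbove a = l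
    · obtain ⟨a, rfl⟩ := hl
      rw [simplexMap_apply_of_injective Fin.succAbove_right_injective, radial_apply h,
        ← Fin.succ_succAbove_succ,
        simplexMap_apply_of_injective Fin.succAbove_right_injective]
    · have hli : l = i := by
        by_contra hne
        exact hl (Fin.exists_succAbove_eq hne)
      subst hli
      rw [simplexMap_apply_of_forall_ne _ (Fin.succAbove_ne _),
        simplexMap_apply_of_forall_ne _ (Fin.succAbove_ne _), zero_div]
  · simp [h, coneWeight_one]

/-- The cone operator on chains. -/
def cone (N : ℕ) (p : StdSpx m) (n : ℕ) :
    SChain (StdSpx m) n →ₗ[ℤ] SChain (StdSpx m) (n + 1) :=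
  Finsupp.lmapDomain ℤ ℤ (coneMap N p)

@[simp] theorem cone_single (N : ℕ) (p : StdSpx m) (σ : C(StdSpx n, StdSpx m)) (a : ℤ) :
    cone N p n (Finsupp.single σ a) = Finsupp.single (coneMap N p σ) a := by
  simp [cone]

theorem bdry_cone (N : ℕ) (p : StdSpx m) (c : SChain (StdSpx m) (n + 1)) :
    bdry (n + 1) (cone N p (n + 1) c) = c - cone N p n (bdry n c) := by
  induction c using Finsupp.induction_linear with
  | zero => simp
  | add c d hc hd =>
    simp only [map_add, hc, hd]
    abel
  | single σ a =>
    rw [cone_single, bdry_single, Fin.sum_univ_succ, bdry_single]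
    simp only [coneMap_comp_zero, coneMap_comp_succ, map_sum, map_smul, cone_single, Fin.val_zero,
      Fin.val_succ, pow_zero, one_smul, pow_succ, mul_neg, mul_one, neg_smul,
      Finset.sum_neg_distrib, sub_eq_add_neg]

/-- A boundary is the boundary of the cone over it, in degree zero as well. -/
theorem bdry_cone_bdry (N : ℕ) (p : StdSpx m) (c : SChain (StdSpx m) (n + 1)) :
    bdry n (cone N p n (bdry n c)) = bdry n c := by
  have h := congrArg (bdry n) (bdry_cone N p c)
  rw [bdry_bdry, map_sub] at h
  exact (sub_eq_zero.1 h.symm).symm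

theorem cone_mem_supported (N : ℕ) (p : StdSpx m) {s : Set C(StdSpx n, StdSpx m)}
    {t : Set C(StdSpx (n + 1), StdSpx m)} (h : ∀ σ ∈ s, coneMap N p σ ∈ t)
    {c : SChain (StdSpx m) n} (hc : c ∈ Finsupp.supported ℤ ℤ s) :
    cone N p n c ∈ Finsupp.supported ℤ ℤ t := by
  refine map_mem_of_mem_supported _ _ (fun σ hσ => ?_) hc
  rw [cone_single]
  exact Finsupp.single_mem_supported ℤ _ (h σ hσ)

end cone

/-! ### Partial nestings -/

/-- A nesting whose open sets need not exhaust the space: the open set of the empty sequence is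
arbitrary. -/
structure PartialNesting (X : Type u) [TopologicalSpace X] where
  toOpens : ∀ {n : ℕ}, (Fin n → X) → TopologicalSpace.Opens X
  mem_of_mem_tail : ∀ {n : ℕ} (x : Fin (n + 1) → X),
    x 0 ∈ toOpens (Fin.tail x) → x 0 ∈ toOpens x
  le_comp : ∀ {m n : ℕ} (f : Fin m → Fin n), Monotone f → ∀ x : Fin n → X,
    toOpens x ≤ toOpens (x ∘ f)

/-- The partial nesting underlying a nesting. -/
def Nesting.toPartialNesting {X : Type u} [TopologicalSpace X] (η : Nesting X) :
    PartialNesting X where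
  toOpens := η.toOpens
  mem_of_mem_tail := η.mem_of_mem_tail
  le_comp := η.le_comp

namespace PartialNesting

variable {X : Type u} {Y : Type v} [TopologicalSpace X] [TopologicalSpace Y]

/-- The open set of the empty sequence. -/
def dom (ζ : PartialNesting X) : TopologicalSpace.Opens X := ζ.toOpens Fin.elim0

theorem mem_const (ζ : PartialNesting X) {p : X} (hp : p ∈ ζ.dom) (n : ℕ) :
    p ∈ ζ.toOpens fun _ : Fin n => p := by
  have h := ζ.mem_of_mem_tail (fun _ : Fin 1 => p) (by
    rwa [Subsingleton.elim (Fin.tail fun _ : Fin 1 => p) Fin.elim0])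
  exact ζ.le_comp (fun _ : Fin n => (0 : Fin 1)) monotone_const _ h

/-- The partial nesting `(x₁, …, xₙ) ↦ ζ (x₁, …, xₙ, p)`. -/
def adjoin (ζ : PartialNesting X) (p : X) : PartialNesting X where
  toOpens {n} x := ζ.toOpens (Fin.snoc (α := fun _ => X) x p : Fin (n + 1) → X)
  mem_of_mem_tail {n} x hx := by
    have h0 : (Fin.snoc (α := fun _ => X) x p : Fin (n + 2) → X) 0 = x 0 :=
      Fin.snoc_castSucc (α := fun _ => X) p x 0
    have ht : Fin.tail (Fin.snoc (α := fun _ => X) x p : Fin (n + 2) → X) =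
        Fin.snoc (α := fun _ => X) (Fin.tail x) p := by
      funext i
      refine Fin.lastCases ?_ (fun i => ?_) i
      · rw [Fin.tail, Fin.succ_last, Fin.snoc_last, Fin.snoc_last]
      · rw [Fin.tail, Fin.succ_castSucc, Fin.snoc_castSucc, Fin.snoc_castSucc, Fin.tail]
    have h := ζ.mem_of_mem_tail (Fin.snoc (α := fun _ => X) x p : Fin (n + 2) → X)
    rw [h0, ht] at h
    exact h hx
  le_comp {m n} f hf x := by
    have h := ζ.le_comp
      (Fin.snoc (α := fun _ => Fin (n + 1)) (fun i => (f i).castSucc) (Fin.last n) :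
        Fin (m + 1) → Fin (n + 1)) ?_ (Fin.snoc (α := fun _ => X) x p)
    · refine h.trans (le_of_eq (congrArg _ (funext fun i => ?_)))
      refine Fin.lastCases ?_ (fun i => ?_) i
      · simp
      · simp
    · intro i j
      refine Fin.lastCases ?_ (fun j => ?_) j
      · intro _
        rw [Fin.snoc_last]
        exact Fin.le_last _
      · refine Fin.lastCases ?_ (fun i => ?_) i
        · intro hij
          exact absurd (Fin.castSucc_lt_last j) (not_lt.2 hij)
        · intro hij
          rw [Fin.snoc_castSucc, Fin.snoc_castSucc]
          exact Fin.castSucc_le_castSucc_iff.2 (hf (Fin.castSucc_le_castSucc_iff.1 hij))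

theorem dom_adjoin (ζ : PartialNesting X) (p : X) :
    (ζ.adjoin p).dom = ζ.toOpens fun _ : Fin 1 => p := by
  refine congrArg ζ.toOpens (funext fun i => ?_)
  refine Fin.lastCases ?_ (fun j => j.elim0) i
  rw [Fin.snoc_last]

/-- The preimage of a partial nesting under a continuous map. -/
def comap (g : C(Y, X)) (ζ : PartialNesting X) : PartialNesting Y where
  toOpens y := TopologicalSpace.Opens.comap g (ζ.toOpens (g ∘ y))
  mem_of_mem_tail y hy := ζ.mem_of_mem_tail (g ∘ y) hy
  le_comp f hf y _ hp := ζ.le_comp f hf (g ∘ y) hp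

theorem mem_dom_comap {g : C(Y, X)} {ζ : PartialNesting X} {y : Y} :
    y ∈ (ζ.comap g).dom ↔ g y ∈ ζ.dom := by
  rw [dom, dom, ← Subsingleton.elim (g ∘ (Fin.elim0 : Fin 0 → Y)) Fin.elim0]
  rfl

theorem adjoin_comap (g : C(Y, X)) (ζ : PartialNesting X) (p : Y) :
    (ζ.comap g).adjoin p = (ζ.adjoin (g p)).comap g := by
  have h : ∀ {n : ℕ} (x : Fin n → Y), ((ζ.comap g).adjoin p).toOpens x =
      ((ζ.adjoin (g p)).comap g).toOpens x := fun {n} x => by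
    change TopologicalSpace.Opens.comap g (ζ.toOpens _) =
      TopologicalSpace.Opens.comap g (ζ.toOpens _)
    rw [Fin.comp_snoc]
  rw [mk.injEq]
  exact funext fun n => funext fun x => h x

/-- The intersection of finitely many partial nestings. -/
def inf (S : Finset (PartialNesting X)) : PartialNesting X where
  toOpens x := S.inf fun ζ => ζ.toOpens x
  mem_of_mem_tail x hx := by
    rw [← SetLike.mem_coe, TopologicalSpace.Opens.coe_finset_inf, Finset.inf_eq_iInf] at hx ⊢
    simp only [Function.comp_apply, Set.iInf_eq_iInter, Set.mem_iInter] at hx ⊢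
    exact fun ζ hζ => ζ.mem_of_mem_tail x (hx ζ hζ)
  le_comp f hf x := Finset.inf_mono_fun fun ζ _ => ζ.le_comp f hf x

theorem mem_inf {S : Finset (PartialNesting X)} {n : ℕ} {x : Fin n → X} {q : X} :
    q ∈ (inf S).toOpens x ↔ ∀ ζ ∈ S, q ∈ ζ.toOpens x := by
  rw [← SetLike.mem_coe, inf, TopologicalSpace.Opens.coe_finset_inf, Finset.inf_eq_iInf]
  simp

/-- A simplex is nested if for every chain of faces, the smallest face is contained in the open set
attached to the barycenters of the chain. -/
def IsNested (ζ : PartialNesting X) {n : ℕ} (σ : C(StdSpx n, X)) : Prop :=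
  ∀ (m : ℕ) (T : Fin (m + 1) → SimplexFace n), Monotone T →
    σ '' (T 0).points ⊆ ζ.toOpens fun i => σ (T i).barycenter

theorem isNested_comap {g : C(Y, X)} {ζ : PartialNesting X} {n : ℕ} {σ : C(StdSpx n, Y)} :
    (ζ.comap g).IsNested σ ↔ ζ.IsNested (g.comp σ) := by
  refine forall_congr' fun m => forall_congr' fun T => forall_congr' fun hT => ?_
  rw [Set.image_subset_iff, Set.image_subset_iff]
  rfl

theorem isNested_inf {S : Finset (PartialNesting X)} {n : ℕ} {σ : C(StdSpx n, X)} :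
    (inf S).IsNested σ ↔ ∀ ζ ∈ S, ζ.IsNested σ := by
  constructor
  · intro h ζ hζ m T hT q hq
    exact mem_inf.1 (h m T hT hq) ζ hζ
  · intro h m T hT q hq
    exact mem_inf.2 fun ζ hζ => h ζ hζ m T hT hq

/-- The chains that are combinations of nested simplices. -/
def nestedChain (ζ : PartialNesting X) (n : ℕ) : Submodule ℤ (SChain X n) :=
  Finsupp.supported ℤ ℤ {σ | ζ.IsNested σ}

theorem single_mem_nestedChain {ζ : PartialNesting X} {n : ℕ} {σ : C(StdSpx n, X)}
    (h : ζ.IsNested σ) (a : ℤ) : Finsupp.single σ a ∈ ζ.nestedChain n :=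
  Finsupp.single_mem_supported ℤ a h

theorem push_mem_nestedChain {g : C(Y, X)} {ζ : PartialNesting X} {n : ℕ} {c : SChain Y n} :
    c ∈ (ζ.comap g).nestedChain n → push g n c ∈ ζ.nestedChain n :=
  push_mem_supported g n fun _ => isNested_comap.1

theorem IsNested.comp_simplexMap {ζ : PartialNesting X} {m n : ℕ} {σ : C(StdSpx n, X)}
    (hσ : ζ.IsNested σ) (f : Fin (m + 1) ↪ Fin (n + 1)) :
    ζ.IsNested (σ.comp (simplexMap f)) := by
  rintro l T hT _ ⟨p, hp, rfl⟩
  have h := hσ l (fun i => (T i).map f)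
    (fun i j hij => Finset.map_subset_map.2 (hT hij))
    ⟨simplexMap f p, SimplexFace.simplexMap_mem_points f _ hp, rfl⟩
  simpa only [ContinuousMap.comp_apply, SimplexFace.simplexMap_barycenter] using h

end PartialNesting

/-- The face `Δ^n` of `Δ^n`. -/
def SimplexFace.top (n : ℕ) : SimplexFace n := ⟨Finset.univ, Finset.univ_nonempty⟩

/-- The barycenter of `Δ^n`. -/
def bary (n : ℕ) : StdSpx n := (SimplexFace.top n).barycenter

theorem bary_apply (n : ℕ) (i : Fin (n + 1)) : bary n i = ((n : ℝ) + 1)⁻¹ := by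
  change (if i ∈ Finset.univ then (((Finset.univ : Finset (Fin (n + 1))).card : ℝ))⁻¹ else 0) = _
  simp

namespace PartialNesting

variable {X : Type u} [TopologicalSpace X] {ζ : PartialNesting X}

/-- A nested simplex is contained in the open set of its barycenter. -/
theorem IsNested.mem_bary {n : ℕ} {σ : C(StdSpx n, X)} (hσ : ζ.IsNested σ) (t : StdSpx n) :
    σ t ∈ (ζ.adjoin (σ (bary n))).dom := by
  rw [dom_adjoin]
  exact hσ 0 (fun _ => SimplexFace.top n) monotone_const
    ⟨t, fun i hi => absurd (Finset.mem_univ i) hi, rfl⟩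

/-- Any chain of faces of a simplex can be prolonged by the simplex itself. -/
theorem IsNested.adjoin_bary {n : ℕ} {σ : C(StdSpx n, X)} (hσ : ζ.IsNested σ) :
    (ζ.adjoin (σ (bary n))).IsNested σ := by
  intro m T hT q hq
  have h := hσ (m + 1) (Fin.snoc (α := fun _ => SimplexFace n) T (SimplexFace.top n)) ?_
  · have h0 : (Fin.snoc (α := fun _ => SimplexFace n) T (SimplexFace.top n) :
        Fin (m + 2) → SimplexFace n) 0 = T 0 :=
      Fin.snoc_castSucc (α := fun _ => SimplexFace n) (SimplexFace.top n) T 0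
    rw [h0] at h
    refine le_of_eq (congrArg ζ.toOpens (funext fun i => ?_)) (h hq)
    refine Fin.lastCases ?_ (fun i => ?_) i
    · rw [Fin.snoc_last, Fin.snoc_last, bary]
    · rw [Fin.snoc_castSucc, Fin.snoc_castSucc]
  · intro i j
    refine Fin.lastCases ?_ (fun j => ?_) j
    · intro _
      rw [Fin.snoc_last]
      exact Finset.subset_univ _
    · refine Fin.lastCases ?_ (fun i => ?_) i
      · intro hij
        exact absurd (Fin.castSucc_lt_last j) (not_lt.2 hij)
      · intro hij
        rw [Fin.snoc_castSucc, Fin.snoc_castSucc]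
        exact hT (Fin.castSucc_le_castSucc_iff.1 hij)

theorem isNested_of_dim_zero {σ : C(StdSpx 0, X)} (h : ∀ t, σ t ∈ ζ.dom) : ζ.IsNested σ := by
  rintro m T - _ ⟨t, -, rfl⟩
  have := ζ.mem_const (h t) (m + 1)
  refine le_of_eq (congrArg ζ.toOpens (funext fun i => ?_)) this
  rw [Subsingleton.elim t]

/-- The cone over a nested simplex is nested if its base is nested after adjoining the apex to all
sequences and the cone lies in the open set of the apex. For `N` large, the barycenters of all
faces that contain the apex go to the apex, so that only these two conditions intervene. -/
theorem IsNested.coneMap {m n N : ℕ} (hN : n + 1 ≤ N) {ζ : PartialNesting (StdSpx m)}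
    {p : StdSpx m} {A : Set (Fin (m + 1) → ℝ)} (hA : StarConvex ℝ (p : Fin (m + 1) → ℝ) A)
    (hAζ : ∀ q : StdSpx m, (q : Fin (m + 1) → ℝ) ∈ A → q ∈ (ζ.adjoin p).dom)
    {σ : C(StdSpx n, StdSpx m)} (hσA : ∀ t, (σ t : Fin (m + 1) → ℝ) ∈ A)
    (hσ : (ζ.adjoin p).IsNested σ) : ζ.IsNested (coneMap N p σ) := by
  -- the barycenter of a face containing the apex goes to the apex
  have hapex : ∀ T : SimplexFace (n + 1), 0 ∈ T.1 → _root_.coneMap N p σ T.barycenter = p := by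
    intro T hT
    have hw : coneWeight N (T.barycenter 0) = 1 := by
      apply coneWeight_of_le
      change _ ≤ if (0 : Fin (n + 2)) ∈ T.1 then (T.1.card : ℝ)⁻¹ else 0
      rw [if_pos hT]
      have hc : T.1.card ≤ N + 1 := by
        have := T.1.card_le_univ
        rw [Fintype.card_fin] at this
        lia
      have hpos : (0 : ℝ) < T.1.card := by exact_mod_cast T.2.card_pos
      exact inv_anti₀ hpos (by exact_mod_cast hc)
    refine DFunLike.ext _ _ fun j => ?_
    rw [coneMap_apply, hw]
    simp
  rintro l T hT _ ⟨t, ht, rfl⟩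
  by_cases h0 : 0 ∈ (T 0).1
  · have hT0 : ∀ i, 0 ∈ (T i).1 := fun i => hT (Fin.zero_le i) h0
    have hmem : _root_.coneMap N p σ t ∈ (ζ.adjoin p).dom := by
      refine hAζ _ ?_
      have := hA (hσA (radial t)) (coneWeight_nonneg N (stdSimplex.zero_le t 0))
        (sub_nonneg.2 (coneWeight_le_one N _)) (add_sub_cancel _ _)
      exact this
    rw [dom_adjoin] at hmem
    simp only [hapex _ (hT0 _)]
    exact ζ.le_comp (fun _ : Fin (l + 1) => (0 : Fin 1)) monotone_const _ hmem
  · -- the chain of the intersections with the base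
    have hsub : ∀ i, (T 0).1 ⊆ (T i).1 := fun i => hT (Fin.zero_le i)
    have hne : ∀ i, (Finset.univ.filter fun a : Fin (n + 1) => a.succ ∈ (T i).1).Nonempty := by
      intro i
      obtain ⟨b, hb⟩ := (T 0).2
      obtain ⟨a, rfl⟩ := Fin.exists_succ_eq.2 (fun h : b = 0 => h0 (h ▸ hb))
      exact ⟨a, by simpa using hsub i hb⟩
    let T' : Fin (l + 1) → SimplexFace n := fun i => ⟨_, hne i⟩
    have hT' : Monotone T' := fun i j hij a ha => by
      simp only [T', Finset.mem_filter_univ] at ha ⊢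
      exact hT hij ha
    have hmap : ∀ i, 0 ∉ (T i).1 → (T' i).map (Fin.succEmb _) = T i := by
      intro i hi
      refine Subtype.ext (Finset.ext fun b => ?_)
      simp only [SimplexFace.map, T', Finset.mem_map, Finset.mem_filter_univ, Fin.coe_succEmb]
      constructor
      · rintro ⟨a, ha, rfl⟩
        exact ha
      · intro hb
        obtain ⟨a, rfl⟩ := Fin.exists_succ_eq.2 (fun h : b = 0 => hi (h ▸ hb))
        exact ⟨a, hb, rfl⟩
    have hbase : ∀ i, 0 ∉ (T i).1 →
        _root_.coneMap N p σ (T i).barycenter = σ (T' i).barycenter := by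
      intro i hi
      rw [← hmap i hi, ← SimplexFace.simplexMap_barycenter]
      exact coneMap_simplexMap_succ N p σ _
    have ht0 : t 0 = 0 := ht 0 h0
    have hpt : _root_.coneMap N p σ t = σ (radial t) := by
      refine DFunLike.ext _ _ fun j => ?_
      rw [coneMap_apply, ht0]
      simp
    have hrad : radial t ∈ (T' 0).points := by
      intro a ha
      rw [radial_apply (by rw [ht0]; exact one_pos), ht _ (by simpa [T'] using ha), zero_div]
    have key := hσ l T' hT' ⟨_, hrad, rfl⟩
    rw [hpt]
    have := ζ.le_comp (fun i : Fin (l + 1) => if 0 ∈ (T i).1 then Fin.last (l + 1) else i.castSucc)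
      ?_ _ key
    · refine le_of_eq (congrArg ζ.toOpens (funext fun i => ?_)) this
      by_cases hi : 0 ∈ (T i).1
      · simp [hi, hapex]
      · simp [hi, hbase]
    · intro i j hij
      by_cases hj : 0 ∈ (T j).1
      · simp only [hj, if_true]
        exact Fin.le_last _
      · have hi : 0 ∉ (T i).1 := fun h => hj (hT hij h)
        simpa [hi, hj] using hij

end PartialNesting

/-! ### Barycentric subdivision -/

/-- The chain of `Δ^n` that defines the homotopy `D` from the identity to barycentric subdivision:
the cone from the barycenter over `ι - D∂ι`, where `ι` is the identity simplex. With this choice the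
subdivision `ι - ∂Dι - D∂ι` is the cone over the subdivided boundary. The operators `transport` are
used with the one-point reference space, where they are natural for all maps. -/
def sdChain : ∀ n, SChain (StdSpx n) (n + 1)
  | 0 => 0
  | n + 1 => cone 0 (bary (n + 1)) (n + 1)
      (fund (n + 1) - transport (fun _ : C(StdSpx n, PUnit.{1}) => sdChain n)
        (ContinuousMap.const _ PUnit.unit) (bdry n (fund (n + 1))))

section

variable {X : Type u} {Y : Type v} [TopologicalSpace X] [TopologicalSpace Y]

/-- The natural homotopy from the identity to barycentric subdivision. -/
def sdHomotopy (n : ℕ) : SChain X n →ₗ[ℤ] SChain X (n + 1) :=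
  transport (fun _ : C(StdSpx n, PUnit.{1}) => sdChain n) (ContinuousMap.const _ PUnit.unit)

/-- Barycentric subdivision. -/
def sd (n : ℕ) : SChain X n →ₗ[ℤ] SChain X n :=
  deform (fun n (_ : C(StdSpx n, PUnit.{1})) => sdChain n) (ContinuousMap.const _ PUnit.unit) n

theorem sd_succ (n : ℕ) (c : SChain X (n + 1)) :
    sd (n + 1) c = c - bdry (n + 1) (sdHomotopy (n + 1) c) - sdHomotopy n (bdry n c) := rfl

theorem bdry_sd (n : ℕ) (c : SChain X (n + 1)) : bdry n (sd (n + 1) c) = sd n (bdry n c) :=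
  bdry_deform _ _ n c

theorem push_sd (f : C(X, Y)) (n : ℕ) (c : SChain X n) : push f n (sd n c) = sd n (push f n c) :=
  push_deform _ (ContinuousMap.const Y PUnit.unit) f n c

theorem sd_fund_zero : sd 0 (fund 0) = fund 0 := by
  rw [sd, deform_zero_apply, fund, transport_single]
  simp [sdChain]

theorem sd_fund_succ (n : ℕ) :
    sd (n + 1) (fund (n + 1)) =
      cone 0 (bary (n + 1)) n (sd n (bdry n (fund (n + 1)))) := by
  have h : sdHomotopy (n + 1) (fund (n + 1)) = cone 0 (bary (n + 1)) (n + 1)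
      (fund (n + 1) - sdHomotopy n (bdry n (fund (n + 1)))) := by
    rw [sdHomotopy, fund, transport_single, push_id]
    rfl
  rw [sd_succ, h, bdry_cone, sd, deform_bdry, map_sub]
  change _ = cone 0 (bary (n + 1)) n
    (bdry n (fund (n + 1)) - bdry n (sdHomotopy n (bdry n (fund (n + 1)))))
  abel

end

/-! ### The mesh of the iterated subdivisions -/

/-- The linear function on `Δ^n` with values `a i` at the vertices. -/
def linForm {n : ℕ} (a : Fin (n + 1) → ℝ) (t : StdSpx n) : ℝ := ∑ i, t i * a i

/-- The map is affine, and composition with it shrinks the oscillation of every affine function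
at least by the factor `r`. -/
def Shrinks {m n : ℕ} (r : ℝ) (ρ : C(StdSpx n, StdSpx m)) : Prop :=
  ∀ a : Fin (m + 1) → ℝ, (∃ b : Fin (n + 1) → ℝ, ∀ t, linForm a (ρ t) = linForm b t) ∧
    ∀ d, (∀ i j, |a i - a j| ≤ d) → ∀ s t, |linForm a (ρ s) - linForm a (ρ t)| ≤ r * d

theorem linForm_vertex {n : ℕ} (a : Fin (n + 1) → ℝ) (i : Fin (n + 1)) :
    linForm a (stdSimplex.vertex i) = a i := by
  have h : ∀ j, (stdSimplex.vertex (S := ℝ) i : StdSpx n) j = if j = i then 1 else 0 := fun j => by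
    have := congrFun (stdSimplex.vertex_coe (S := ℝ) i) j
    rw [Pi.single_apply] at this
    exact this
  simp [linForm, h]

theorem Shrinks.mono {m n : ℕ} {r r' : ℝ} (hr : r ≤ r') {ρ : C(StdSpx n, StdSpx m)}
    (h : Shrinks r ρ) : Shrinks r' ρ := fun a => ⟨(h a).1, fun d hd s t =>
  ((h a).2 d hd s t).trans (mul_le_mul_of_nonneg_right hr ((abs_nonneg _).trans (hd 0 0)))⟩

theorem Shrinks.comp {l m n : ℕ} {r s : ℝ} {ρ : C(StdSpx m, StdSpx l)} {τ : C(StdSpx n, StdSpx m)}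
    (hρ : Shrinks r ρ) (hτ : Shrinks s τ) : Shrinks (s * r) (ρ.comp τ) := by
  intro a
  obtain ⟨b, hb⟩ := (hρ a).1
  obtain ⟨c, hc⟩ := (hτ b).1
  refine ⟨⟨c, fun t => (hb _).trans (hc t)⟩, fun d hd x y => ?_⟩
  rw [ContinuousMap.comp_apply, ContinuousMap.comp_apply, hb, hb, mul_assoc]
  refine (hτ b).2 _ (fun i j => ?_) x y
  have := (hρ a).2 d hd (stdSimplex.vertex i) (stdSimplex.vertex j)
  rwa [hb, hb, linForm_vertex, linForm_vertex] at this

theorem linForm_sub_const {n : ℕ} (a : Fin (n + 1) → ℝ) (B : ℝ) (t : StdSpx n) :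
    linForm a t - B = ∑ i, t i * (a i - B) := by
  simp only [mul_sub, Finset.sum_sub_distrib, ← Finset.sum_mul, stdSimplex.sum_eq_one, one_mul,
    linForm]

theorem abs_linForm_sub_le {n : ℕ} {a : Fin (n + 1) → ℝ} {B d : ℝ} (h : ∀ i, |a i - B| ≤ d)
    (t : StdSpx n) : |linForm a t - B| ≤ d := by
  rw [linForm_sub_const]
  calc |∑ i, t i * (a i - B)| ≤ ∑ i, t i * d := by
        refine (Finset.abs_sum_le_sum_abs _ _).trans (Finset.sum_le_sum fun i _ => ?_)
        rw [abs_mul, abs_of_nonneg (stdSimplex.zero_le t i)]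
        exact mul_le_mul_of_nonneg_left (h i) (stdSimplex.zero_le t i)
    _ = d := by rw [← Finset.sum_mul, stdSimplex.sum_eq_one, one_mul]

theorem linForm_simplexMap {m n : ℕ} (f : Fin (n + 1) → Fin (m + 1)) (a : Fin (m + 1) → ℝ)
    (t : StdSpx n) : linForm a (simplexMap f t) = linForm (a ∘ f) t := by
  simp only [linForm, simplexMap_apply, Finset.sum_mul, Function.comp_apply]
  rw [← Finset.sum_fiberwise Finset.univ f fun i => t i * a (f i)]
  refine Finset.sum_congr rfl fun j _ => Finset.sum_congr rfl fun i hi => ?_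
  rw [(Finset.mem_filter.1 hi).2]

theorem abs_linForm_bary_sub_le {n : ℕ} {a : Fin (n + 1) → ℝ} {d : ℝ}
    (h : ∀ i j, |a i - a j| ≤ d) (j : Fin (n + 1)) :
    |a j - linForm a (bary n)| ≤ (n : ℝ) / (n + 1) * d := by
  have hn : (0 : ℝ) < n + 1 := by positivity
  rw [abs_sub_comm, linForm_sub_const, Fin.sum_univ_succAbove _ j]
  simp only [bary_apply, sub_self, mul_zero, zero_add]
  calc |∑ i : Fin n, ((n : ℝ) + 1)⁻¹ * (a (j.succAbove i) - a j)|
      ≤ ∑ _i : Fin n, ((n : ℝ) + 1)⁻¹ * d := by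
        refine (Finset.abs_sum_le_sum_abs _ _).trans (Finset.sum_le_sum fun i _ => ?_)
        rw [abs_mul, abs_of_pos (inv_pos.2 hn)]
        exact mul_le_mul_of_nonneg_left (h _ _) (inv_pos.2 hn).le
    _ = (n : ℝ) / (n + 1) * d := by
        rw [Finset.sum_const, Finset.card_univ, Fintype.card_fin, nsmul_eq_mul]
        field_simp

theorem abs_convexCombo_sub_le {x y z s t D : ℝ} (hs : 0 ≤ s) (hs1 : s ≤ 1) (ht : 0 ≤ t)
    (ht1 : t ≤ 1) (hx : |x - z| ≤ D) (hy : |y - z| ≤ D) (hxy : |x - y| ≤ D) :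
    |(s * z + (1 - s) * x) - (t * z + (1 - t) * y)| ≤ D := by
  have hD : 0 ≤ D := (abs_nonneg _).trans hx
  have h1 : (s * z + (1 - s) * x) - (t * z + (1 - t) * y) =
      (1 - s) * t * (x - z) + s * (1 - t) * (z - y) + (1 - s) * (1 - t) * (x - y) := by ring
  rw [abs_sub_comm] at hy
  have e1 : 0 ≤ (1 - s) * t := mul_nonneg (sub_nonneg.2 hs1) ht
  have e2 : 0 ≤ s * (1 - t) := mul_nonneg hs (sub_nonneg.2 ht1)
  have e3 : 0 ≤ (1 - s) * (1 - t) := mul_nonneg (sub_nonneg.2 hs1) (sub_nonneg.2 ht1)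
  rw [h1]
  calc _ ≤ |(1 - s) * t * (x - z)| + |s * (1 - t) * (z - y)| + |(1 - s) * (1 - t) * (x - y)| :=
        abs_add_three _ _ _
    _ ≤ (1 - s) * t * D + s * (1 - t) * D + (1 - s) * (1 - t) * D := by
        rw [abs_mul ((1 - s) * t), abs_mul (s * (1 - t)), abs_mul ((1 - s) * (1 - t)),
          abs_of_nonneg e1, abs_of_nonneg e2, abs_of_nonneg e3]
        gcongr
    _ ≤ D := by
        have : 0 ≤ s * t * D := mul_nonneg (mul_nonneg hs ht) hD
        linarith

theorem linForm_coneMap {m n : ℕ} (a : Fin (m + 1) → ℝ) (p : StdSpx m)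
    (σ : C(StdSpx n, StdSpx m)) (t : StdSpx (n + 1)) :
    linForm a (coneMap 0 p σ t) = t 0 * linForm a p + (1 - t 0) * linForm a (σ (radial t)) := by
  have hw : coneWeight 0 (t 0) = t 0 := by
    simp [coneWeight]
  simp only [linForm, coneMap_apply, hw, Finset.mul_sum, ← Finset.sum_add_distrib]
  exact Finset.sum_congr rfl fun j _ => by ring

/-- The simplices of the barycentric subdivision of `Δ^n` have at most `n / (n + 1)` times its
size: they are cones from the barycenter over subdivided simplices of the boundary. -/
theorem sd_fund_mem_supported (n : ℕ) :
    sd n (fund n) ∈ Finsupp.supported ℤ ℤ {ρ | Shrinks ((n : ℝ) / (n + 1)) ρ} := by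
  induction n with
  | zero =>
    rw [sd_fund_zero]
    refine Finsupp.single_mem_supported ℤ _ fun a => ⟨⟨a, fun t => rfl⟩, fun d _ s t => ?_⟩
    rw [Subsingleton.elim s t]
    simp
  | succ n ih =>
    rw [sd_fund_succ, fund, bdry_single, map_sum, map_sum]
    refine sum_mem fun i _ => ?_
    rw [map_smul, map_smul, ← push_fund, ← push_sd]
    refine Submodule.smul_mem _ _ (cone_mem_supported 0 _ (fun σ hσ => hσ)
      (push_mem_supported _ n (fun τ hτ => ?_) ih))
    rw [ContinuousMap.id_comp]
    change Shrinks _ _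
    intro a
    obtain ⟨b, hb⟩ := (hτ (a ∘ i.succAbove)).1
    have hval : ∀ t, linForm a (coneMap 0 (bary (n + 1))
        ((simplexMap i.succAbove).comp τ) t) = t 0 * linForm a (bary (n + 1)) +
          (1 - t 0) * linForm (a ∘ i.succAbove) (τ (radial t)) := fun t => by
      rw [linForm_coneMap, ContinuousMap.comp_apply, linForm_simplexMap]
    refine ⟨⟨Fin.cons (linForm a (bary (n + 1))) b, fun t => ?_⟩, fun d hd s t => ?_⟩
    · have hcons : ∀ B : ℝ, linForm (Fin.cons B b : Fin (n + 2) → ℝ) t =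
          t 0 * B + ∑ l : Fin (n + 1), t l.succ * b l := fun B => by
        simp [linForm, Fin.sum_univ_succ]
      rw [hval, hb, hcons, show linForm b (radial t) = ∑ l, radial t l * b l from rfl,
        Finset.mul_sum]
      congr 1
      refine Finset.sum_congr rfl fun l _ => ?_
      rcases (stdSimplex.le_one t 0).lt_or_eq with h | h
      · rw [radial_apply h]
        field_simp [(sub_pos.2 h).ne']
      · have h1 := stdSimplex.sum_eq_one t
        rw [Fin.sum_univ_succ, h, add_eq_left,
          Finset.sum_eq_zero_iff_of_nonneg fun j _ => stdSimplex.zero_le t _] at h1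
        rw [h1 l (Finset.mem_univ _), h]
        simp
    · rw [hval, hval]
      have hb1 : ∀ x : StdSpx n, |linForm (a ∘ i.succAbove) x - linForm a (bary (n + 1))| ≤
          ((n + 1 : ℕ) : ℝ) / ((n + 1 : ℕ) + 1) * d := fun x =>
        abs_linForm_sub_le (fun j => abs_linForm_bary_sub_le hd _) x
      refine abs_convexCombo_sub_le (stdSimplex.zero_le _ _) (stdSimplex.le_one _ _)
        (stdSimplex.zero_le _ _) (stdSimplex.le_one _ _) (hb1 _) (hb1 _) ?_
      refine ((hτ _).2 d (fun j k => hd _ _) _ _).trans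
        (mul_le_mul_of_nonneg_right ?_ ((abs_nonneg _).trans (hd 0 0)))
      push_cast
      rw [div_le_div_iff₀ (by positivity) (by positivity)]
      nlinarith

theorem sd_pow_fund_mem_supported (n N : ℕ) :
    (sd n ^ N) (fund n) ∈ Finsupp.supported ℤ ℤ {ρ | Shrinks (((n : ℝ) / (n + 1)) ^ N) ρ} := by
  induction N with
  | zero =>
    refine Finsupp.single_mem_supported ℤ _ fun a => ⟨⟨a, fun t => rfl⟩, fun d hd s t => ?_⟩
    rw [pow_zero, one_mul]
    refine abs_linForm_sub_le (fun i => ?_) _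
    rw [abs_sub_comm]
    exact abs_linForm_sub_le (fun j => hd _ _) _
  | succ N ih =>
    rw [pow_succ' (sd n), Module.End.mul_apply]
    refine map_mem_of_mem_supported _ _ (fun ρ hρ => ?_) ih
    rw [← push_fund, ← push_sd]
    refine push_mem_supported ρ n (fun τ hτ => ?_) (sd_fund_mem_supported n)
    rw [pow_succ']
    exact Shrinks.comp hρ hτ

theorem Shrinks.dist_le {m n : ℕ} {r : ℝ} {ρ : C(StdSpx n, StdSpx m)} (h : Shrinks r ρ)
    (hr : 0 ≤ r) (s t : StdSpx n) : dist (ρ s) (ρ t) ≤ r := by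
  rw [Subtype.dist_eq, dist_pi_le_iff hr]
  intro j
  have h1 : ∀ i k : Fin (m + 1),
      |(Pi.single j 1 : Fin (m + 1) → ℝ) i - (Pi.single j 1 : Fin (m + 1) → ℝ) k| ≤ 1 :=
    fun i k => by
      simp only [Pi.single_apply]
      split_ifs <;> simp
  have h2 := (h (Pi.single j 1)).2 1 h1 s t
  simp only [linForm, Pi.single_apply, mul_ite, mul_one, mul_zero, Finset.sum_ite_eq',
    Finset.mem_univ, if_true] at h2
  exact h2

section refine

variable {X : Type u} {Y : Type v} [TopologicalSpace X] [TopologicalSpace Y]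

theorem push_sd_pow (f : C(X, Y)) (n N : ℕ) (c : SChain X n) :
    push f n ((sd n ^ N) c) = (sd n ^ N) (push f n c) := by
  induction N with
  | zero => rfl
  | succ N ih => rw [pow_succ', Module.End.mul_apply, push_sd, ih, pow_succ', Module.End.mul_apply]

theorem bdry_sd_pow (n N : ℕ) (c : SChain X (n + 1)) :
    bdry n ((sd (n + 1) ^ N) c) = (sd n ^ N) (bdry n c) := by
  induction N with
  | zero => rfl
  | succ N ih => rw [pow_succ', Module.End.mul_apply, bdry_sd, ih, pow_succ', Module.End.mul_apply]

/-- The operators `transport` move a simplex inside its image. -/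
theorem transport_mem_supported {Z : Type w} [TopologicalSpace Z] {n : ℕ}
    (h : C(StdSpx n, Z) → SChain (StdSpx n) (n + 1)) (g : C(X, Z)) {s : Set C(StdSpx n, X)}
    {t : Set C(StdSpx (n + 1), X)}
    (hst : ∀ τ ∈ s, ∀ ρ ∈ (h (g.comp τ)).support, τ.comp ρ ∈ t) {c : SChain X n}
    (hc : c ∈ Finsupp.supported ℤ ℤ s) : transport h g c ∈ Finsupp.supported ℤ ℤ t := by
  refine map_mem_of_mem_supported _ _ (fun τ hτ => ?_) hc
  rw [transport_single]
  exact push_mem_supported τ _ (fun ρ hρ => hst τ hτ ρ hρ)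
    (Finsupp.mem_supported_support ℤ (h (g.comp τ)))

/-- For a simplex of `X` and an open cover of `X`, all sufficiently fine barycentric subdivisions
consist of simplices that lie in a set of the cover. -/
theorem exists_forall_sd_pow_small {ι : Type*} {U : ι → Set X} (hU : ∀ i, IsOpen (U i))
    (hcov : ∀ x, ∃ i, x ∈ U i) {n : ℕ} (σ : C(StdSpx n, X)) :
    ∃ N₀, ∀ N, N₀ ≤ N → (sd n ^ N) (Finsupp.single σ 1) ∈
      Finsupp.supported ℤ ℤ {τ | ∃ i, ∀ t, τ t ∈ U i} := by
  obtain ⟨δ, hδ, hball⟩ := lebesgue_number_lemma_of_metric (c := fun i => σ ⁻¹' U i)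
    (isCompact_univ (X := StdSpx n)) (fun i => (hU i).preimage σ.continuous)
    (fun t _ => Set.mem_iUnion.2 (hcov (σ t)))
  have hr0 : (0 : ℝ) ≤ (n : ℝ) / (n + 1) := by positivity
  have hr1 : (n : ℝ) / (n + 1) < 1 := by
    rw [div_lt_one (by positivity)]
    linarith
  obtain ⟨N₀, hN₀⟩ := exists_pow_lt_of_lt_one hδ hr1
  refine ⟨N₀, fun N hN => ?_⟩
  rw [← push_fund, ← push_sd_pow]
  refine push_mem_supported σ n (fun ρ hρ => ?_) (sd_pow_fund_mem_supported n N)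
  obtain ⟨i, hi⟩ := hball (ρ (stdSimplex.vertex 0)) (Set.mem_univ _)
  refine ⟨i, fun t => hi ?_⟩
  exact ((Shrinks.dist_le hρ (pow_nonneg hr0 N) _ _).trans
    (pow_le_pow_of_le_one hr0 hr1.le hN)).trans_lt hN₀

/-- A chain can be replaced, without changing its boundary, by a chain each of whose simplices lies
in a set of a given open cover or factors through a simplex of the boundary. -/
theorem exists_refinement {ι : Type*} {U : ι → Set X} (hU : ∀ i, IsOpen (U i))
    (hcov : ∀ x, ∃ i, x ∈ U i) {n : ℕ} (z : SChain X (n + 1)) :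
    ∃ z' : SChain X (n + 1), bdry n z' = bdry n z ∧ z' ∈ Finsupp.supported ℤ ℤ
      {σ | (∃ i, ∀ t, σ t ∈ U i) ∨ ∃ τ ∈ (bdry n z).support, ∃ ρ, σ = τ.comp ρ} := by
  let P : Set C(StdSpx (n + 1), X) :=
    {σ | (∃ i, ∀ t, σ t ∈ U i) ∨ ∃ τ ∈ (bdry n z).support, ∃ ρ, σ = τ.comp ρ}
  -- the homotopy to the subdivision of the boundary is a chain in the boundary
  have hcollar : ∀ N, ∃ e ∈ Finsupp.supported ℤ ℤ P,
      bdry n ((sd (n + 1) ^ N) z + e) = bdry n z := by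
    intro N
    induction N with
    | zero => exact ⟨0, zero_mem _, by simp⟩
    | succ N ih =>
      obtain ⟨e, he, hbe⟩ := ih
      have hsupp : (sd n ^ N) (bdry n z) ∈ Finsupp.supported ℤ ℤ
          {σ | ∃ τ ∈ (bdry n z).support, ∃ ρ, σ = τ.comp ρ} := by
        refine map_mem_of_mem_supported _ _ (fun τ hτ => ?_)
          (Finsupp.mem_supported_support ℤ (bdry n z))
        rw [← push_fund, ← push_sd_pow]
        refine push_mem_supported τ n (s := Set.univ) (fun ρ _ => ?_)
          (by simp [Finsupp.supported_univ])
        exact ⟨τ, hτ, ρ, rfl⟩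
      refine ⟨e + sdHomotopy n ((sd n ^ N) (bdry n z)), add_mem he ?_, ?_⟩
      · refine transport_mem_supported _ _ ?_ hsupp
        rintro _ ⟨τ, hτ, ρ, rfl⟩ ρ' _
        exact Or.inr ⟨τ, hτ, ρ.comp ρ', rfl⟩
      · rw [pow_succ', Module.End.mul_apply, sd_succ, bdry_sd_pow, ← hbe]
        simp only [map_add, map_sub, bdry_bdry]
        abel
  choose! N₀ hN₀ using fun σ : C(StdSpx (n + 1), X) => exists_forall_sd_pow_small hU hcov σ
  obtain ⟨e, he, hbe⟩ := hcollar (z.support.sup N₀)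
  refine ⟨_, hbe, add_mem ?_ he⟩
  refine map_mem_of_mem_supported _ _ (fun σ hσ => ?_) (Finsupp.mem_supported_support ℤ z)
  exact Finsupp.supported_mono (fun τ hτ => Or.inl hτ)
    (hN₀ σ _ (Finset.le_sup (f := N₀) hσ))

end refine

/-! ### Deformation into nested chains -/

section

variable {X : Type u} {Y : Type v} [TopologicalSpace X] [TopologicalSpace Y]

/-- The faces of the simplices in `s`, in all dimensions. -/
def facesOf {n : ℕ} (s : Set C(StdSpx n, X)) (m : ℕ) : Set C(StdSpx m, X) :=
  {τ | ∃ σ ∈ s, ∃ f : Fin (m + 1) ↪o Fin (n + 1), σ.comp (simplexMap f) = τ}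

theorem finite_facesOf {n : ℕ} {s : Set C(StdSpx n, X)} (hs : s.Finite) (m : ℕ) :
    (facesOf s m).Finite := by
  have hf : Finite (Fin (m + 1) ↪o Fin (n + 1)) :=
    Finite.of_injective (fun f => (f : Fin (m + 1) → Fin (n + 1))) DFunLike.coe_injective
  refine ((hs.prod (Set.finite_univ (α := Fin (m + 1) ↪o Fin (n + 1)))).image
    fun q => q.1.comp (simplexMap q.2)).subset ?_
  rintro _ ⟨σ, hσ, f, rfl⟩
  exact ⟨(σ, f), ⟨hσ, Set.mem_univ _⟩, rfl⟩

theorem comp_succAbove_mem_facesOf {n : ℕ} (s : Set C(StdSpx n, X)) (m : ℕ) :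
    ∀ τ ∈ facesOf s (m + 1), ∀ i : Fin (m + 2),
      τ.comp (simplexMap i.succAbove) ∈ facesOf s m := by
  rintro _ ⟨σ, hσ, f, rfl⟩ i
  refine ⟨σ, hσ, i.succAboveOrderEmb.trans f, ?_⟩
  rw [ContinuousMap.comp_assoc, simplexMap_comp]
  rfl

theorem simplexMap_id (n : ℕ) : simplexMap (id : Fin (n + 1) → Fin (n + 1)) =
    ContinuousMap.id _ := by
  ext1 t
  exact stdSimplex.map_id_apply t

theorem subset_facesOf {n : ℕ} (s : Set C(StdSpx n, X)) : s ⊆ facesOf s n := fun σ hσ =>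
  ⟨σ, hσ, (OrderIso.refl _).toOrderEmbedding, by
    change σ.comp (simplexMap id) = σ
    rw [simplexMap_id, ContinuousMap.comp_id]⟩

/-- In dimensions at most `n` and on the simplices in `F`, the operators `transport` defined by `h`
preserve nested chains for all `ζ ∈ S`, and `deform` turns the simplices in the domain of `ζ ∈ S`
into `ζ`-nested chains. The conditions are on the chains `h σ` in the standard simplex, before they
are transported by `σ`. -/
def Adapted (S : Finset (PartialNesting X)) (F : ∀ m, Set C(StdSpx m, X)) (n : ℕ)
    (h : ∀ m, C(StdSpx m, X) → SChain (StdSpx m) (m + 1)) : Prop :=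
  ∀ m ≤ n, ∀ σ ∈ F m, ∀ ζ ∈ S,
    (ζ.IsNested σ → h m σ ∈ (ζ.comap σ).nestedChain (m + 1)) ∧
    ((∀ t, σ t ∈ ζ.dom) → deform h σ m (fund m) ∈ (ζ.comap σ).nestedChain m)

namespace Adapted

variable {S : Finset (PartialNesting X)} {F : ∀ m, Set C(StdSpx m, X)} {n : ℕ}
  {h : ∀ m, C(StdSpx m, X) → SChain (StdSpx m) (m + 1)} {ζ : PartialNesting X}

theorem transport_mem (H : Adapted S F n h) (hζ : ζ ∈ S) (g : C(Y, X)) {m : ℕ} (hm : m ≤ n)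
    {c : SChain Y m} (hc : c ∈ Finsupp.supported ℤ ℤ {τ | g.comp τ ∈ F m})
    (hcζ : c ∈ (ζ.comap g).nestedChain m) :
    transport (h m) g c ∈ (ζ.comap g).nestedChain (m + 1) := by
  have hc' : c ∈ Finsupp.supported ℤ ℤ
      ({τ | g.comp τ ∈ F m} ∩ {τ | (ζ.comap g).IsNested τ}) := by
    rw [Finsupp.supported_inter]
    exact ⟨hc, hcζ⟩
  refine map_mem_of_mem_supported _ _ (fun τ hτ => ?_) hc'
  rw [transport_single]
  exact PartialNesting.push_mem_nestedChain
    ((H m hm _ hτ.1 ζ hζ).1 (PartialNesting.isNested_comap.1 hτ.2))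

theorem deform_mem (H : Adapted S F n h) (hζ : ζ ∈ S) (g : C(Y, X)) (hg : ∀ y, g y ∈ ζ.dom)
    {m : ℕ} (hm : m ≤ n) {c : SChain Y m}
    (hc : c ∈ Finsupp.supported ℤ ℤ {τ | g.comp τ ∈ F m}) :
    deform h g m c ∈ (ζ.comap g).nestedChain m := by
  refine map_mem_of_mem_supported _ _ (fun τ hτ => ?_) hc
  rw [← push_fund, ← push_deform]
  exact PartialNesting.push_mem_nestedChain ((H m hm _ hτ ζ hζ).2 fun t => hg _)

end Adapted

end

/-- In dimensions at most `n`, every space has adapted operators, for every finite set of partial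
nestings and every finite set of simplices that is closed under faces. -/
def HasAdapted (n : ℕ) : Prop :=
  ∀ (X : Type u) [TopologicalSpace X] (S : Finset (PartialNesting X))
    (F : ∀ m, Set C(StdSpx m, X)), (∀ m, (F m).Finite) →
    (∀ m, ∀ σ ∈ F (m + 1), ∀ i : Fin (m + 2), σ.comp (simplexMap i.succAbove) ∈ F m) →
    ∃ h, Adapted S F n h

/-- For every nesting of `Δ^{n+1}`, the nested `n`-chains that are boundaries are boundaries of
nested chains. -/
def FillsBoundaries (n : ℕ) : Prop :=
  ∀ η : PartialNesting (StdSpx (n + 1)), (∀ t, t ∈ η.dom) → ∀ z : SChain (StdSpx (n + 1)) (n + 1),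
    bdry n z ∈ η.nestedChain n → ∃ x ∈ η.nestedChain (n + 1), bdry n x = bdry n z

theorem hasAdapted_zero : HasAdapted.{u} 0 := by
  intro X _ S F _ _
  refine ⟨fun _ _ => 0, fun m hm σ _ ζ _ => ?_⟩
  obtain rfl : m = 0 := Nat.le_zero.1 hm
  refine ⟨fun _ => zero_mem _, fun hσ => ?_⟩
  have h0 : deform (fun m (_ : C(StdSpx m, X)) => (0 : SChain (StdSpx m) (m + 1))) σ 0 (fund 0) =
      fund 0 := by
    rw [deform_zero_apply, fund, transport_single]
    simp
  rw [h0]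
  exact PartialNesting.single_mem_nestedChain (PartialNesting.isNested_of_dim_zero fun t =>
    PartialNesting.mem_dom_comap.2 (hσ t)) 1

/-- A boundary that is nested after adjoining `g p` bounds a nested chain, if it comes from a part
of a simplex that is star-shaped about `p` and lies in the open set of `g p`. -/
theorem exists_nested_filling_of_starConvex {X : Type u} [TopologicalSpace X]
    {ζ : PartialNesting X} {k m n : ℕ} (g : C(StdSpx m, X)) (σ : C(StdSpx k, StdSpx m))
    {p : StdSpx m} {A : Set (Fin (m + 1) → ℝ)} (hA : StarConvex ℝ (p : Fin (m + 1) → ℝ) A)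
    (hAζ : ∀ q : StdSpx m, (q : Fin (m + 1) → ℝ) ∈ A → g q ∈ (ζ.adjoin (g p)).dom)
    (hσA : ∀ t, (σ t : Fin (m + 1) → ℝ) ∈ A) {c : SChain (StdSpx k) (n + 1)}
    (hc : bdry n c ∈ ((ζ.adjoin (g p)).comap (g.comp σ)).nestedChain n) :
    push (g.comp σ) n (bdry n c) ∈ (ζ.nestedChain (n + 1)).map (bdry n) := by
  refine ⟨push g (n + 1) (cone (n + 1) p n (push σ n (bdry n c))), ?_, ?_⟩
  · refine PartialNesting.push_mem_nestedChain (cone_mem_supported _ p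
      (s := {τ | (∀ t, (τ t : Fin (m + 1) → ℝ) ∈ A) ∧ ((ζ.comap g).adjoin p).IsNested τ})
      (fun τ hτ => ?_) (push_mem_supported σ n (fun τ hτ => ?_) hc))
    · refine PartialNesting.IsNested.coneMap le_rfl hA (fun q hq => ?_) hτ.1 hτ.2
      rw [PartialNesting.adjoin_comap]
      exact PartialNesting.mem_dom_comap.2 (hAζ q hq)
    · refine ⟨fun t => hσA _, ?_⟩
      rw [PartialNesting.adjoin_comap]
      exact PartialNesting.isNested_comap.2
        ((PartialNesting.isNested_comap (g := g.comp σ) (σ := τ)).1 hτ)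
  · rw [bdry_push, ← bdry_push σ, bdry_cone_bdry, bdry_push σ, push_push]

/-- Deform a fine filling of the boundary and replace each of its simplices by a cone. -/
theorem fillsBoundaries_of_hasAdapted {n : ℕ} (H : HasAdapted.{0} n) : FillsBoundaries n := by
  classical
  intro η hη z hz
  have hopen : ∀ x : StdSpx (n + 1), ∃ ε > 0, Metric.ball x ε ⊆ (η.adjoin x).dom := fun x => by
    refine Metric.isOpen_iff.1 (η.adjoin x).dom.isOpen x ?_
    rw [PartialNesting.dom_adjoin]
    exact η.mem_const (hη x) 1
  choose ε hε hball using hopen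
  obtain ⟨z', hzz', hz'⟩ := exists_refinement (U := fun x => Metric.ball x (ε x))
    (fun _ => Metric.isOpen_ball) (fun x => ⟨x, Metric.mem_ball_self (hε x)⟩) z
  -- every simplex of `z'` can be coned off inside the open set of a suitable apex
  have hcone : ∀ σ ∈ z'.support, ∃ x, (∀ t, σ t ∈ (η.adjoin x).dom) ∧
      ∀ c : SChain (StdSpx (n + 1)) (n + 1),
        bdry n c ∈ ((η.adjoin x).comap σ).nestedChain n →
          push σ n (bdry n c) ∈ (η.nestedChain (n + 1)).map (bdry n) := by
    intro σ hσ
    rcases (Finsupp.mem_supported ℤ z').1 hz' hσ with ⟨x, hx⟩ | ⟨τ, hτ, ρ, rfl⟩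
    · refine ⟨x, fun t => hball x (hx t), fun c hc => ?_⟩
      exact exists_nested_filling_of_starConvex (ContinuousMap.id _) σ (p := x)
        (A := Metric.ball (x : Fin (n + 2) → ℝ) (ε x))
        ((convex_ball _ _).starConvex (Metric.mem_ball_self (hε x)))
        (fun q hq => hball x hq) (fun t => hx t) hc
    · have hτη : η.IsNested τ := (Finsupp.mem_supported ℤ (bdry n z)).1 hz hτ
      refine ⟨τ (bary n), fun t => hτη.mem_bary _, fun c hc => ?_⟩
      exact exists_nested_filling_of_starConvex τ ρ (p := bary n) (A := Set.univ)
        (starConvex_univ _) (fun q _ => hτη.mem_bary q) (fun _ => Set.mem_univ _) hc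
  choose! x hx hfill using hcone
  obtain ⟨h, hh⟩ := H (StdSpx (n + 1))
    (insert η (z'.support.image fun σ => η.adjoin (x σ)))
    (facesOf (z'.support : Set C(StdSpx (n + 1), StdSpx (n + 1))))
    (finite_facesOf z'.support.finite_toSet) (comp_succAbove_mem_facesOf _)
  have hmem : deform h (ContinuousMap.id _) n (bdry n z') ∈
      (η.nestedChain (n + 1)).map (bdry n) := by
    refine map_mem_of_mem_supported
      (deform h (ContinuousMap.id (StdSpx (n + 1))) n ∘ₗ bdry n) _ (fun σ hσ => ?_)
      (Finsupp.mem_supported_support ℤ z')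
    have hfaces : bdry n (fund (n + 1)) ∈ Finsupp.supported ℤ ℤ
        {τ | σ.comp τ ∈ facesOf (z'.support : Set C(StdSpx (n + 1), StdSpx (n + 1))) n} := by
      refine bdry_mem_supported n (s := {ContinuousMap.id _}) ?_
        (Finsupp.single_mem_supported ℤ _ rfl)
      rintro _ rfl i
      exact comp_succAbove_mem_facesOf _ n σ (subset_facesOf _ hσ) i
    have := hfill σ hσ (deform h σ (n + 1) (fund (n + 1))) (by
      rw [bdry_deform]
      exact hh.deform_mem (Finset.mem_insert_of_mem (Finset.mem_image_of_mem _ hσ)) σ (hx σ hσ)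
        le_rfl hfaces)
    rw [bdry_deform] at this
    rw [LinearMap.comp_apply, ← push_fund, bdry_push, ← push_deform]
    exact this
  rw [hzz', deform_bdry] at hmem
  obtain ⟨w, hw, hbw⟩ := hmem
  refine ⟨w + transport (h n) (ContinuousMap.id _) (bdry n z), add_mem hw ?_, ?_⟩
  · refine hh.transport_mem (Finset.mem_insert_self _ _) (ContinuousMap.id _) le_rfl ?_ hz
    rw [← hzz']
    exact bdry_mem_supported n (fun σ hσ => comp_succAbove_mem_facesOf _ n σ (subset_facesOf _ hσ))
      (Finsupp.mem_supported_support ℤ z')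
  · rw [map_add, hbw, sub_add_cancel]

/-- The value of the operators on an `(n + 1)`-simplex `σ` is the cone from the barycenter over the
difference of `ι - h∂ι` and a filling of its boundary that is nested for all partial nestings whose
domain contains the image of `σ`. -/
theorem hasAdapted_succ {n : ℕ} (H : HasAdapted.{u} n) (Q : FillsBoundaries n) :
    HasAdapted.{u} (n + 1) := by
  classical
  intro X _ S F hF hface
  -- adjoin to the partial nestings in `S` the barycenters of the new simplices
  obtain ⟨h, hh⟩ := H X
    (S ∪ (S ×ˢ (hF (n + 1)).toFinset).image fun q => q.1.adjoin (q.2 (bary (n + 1)))) F hF hface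
  set S' := S ∪ (S ×ˢ (hF (n + 1)).toFinset).image fun q => q.1.adjoin (q.2 (bary (n + 1)))
  have hSS' : ∀ ζ ∈ S, ζ ∈ S' := fun ζ hζ => Finset.mem_union_left _ hζ
  have hnew : ∀ σ ∈ F (n + 1), ∃ w : SChain (StdSpx (n + 1)) (n + 2), ∀ ζ ∈ S,
      (ζ.IsNested σ → w ∈ (ζ.comap σ).nestedChain (n + 2)) ∧
      ((∀ t, σ t ∈ ζ.dom) → fund (n + 1) - bdry (n + 1) w -
        transport (h n) σ (bdry n (fund (n + 1))) ∈ (ζ.comap σ).nestedChain (n + 1)) := by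
    intro σ hσ
    have hfaces : bdry n (fund (n + 1)) ∈ Finsupp.supported ℤ ℤ {τ | σ.comp τ ∈ F n} := by
      refine bdry_mem_supported n (s := {ContinuousMap.id _}) ?_
        (Finsupp.single_mem_supported ℤ _ rfl)
      rintro _ rfl i
      exact hface n σ hσ i
    set z := fund (n + 1) - transport (h n) σ (bdry n (fund (n + 1))) with hz
    have hbz : bdry n z = deform h σ n (bdry n (fund (n + 1))) := by
      rw [hz, map_sub, deform_bdry]
    -- all conditions that the image of the simplex under `deform` has to satisfy
    set η := PartialNesting.inf
      ((S'.filter fun ζ => ∀ t, σ t ∈ ζ.dom).image fun ζ => ζ.comap σ)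
    obtain ⟨x, hx, hbx⟩ := Q η (fun t => PartialNesting.mem_inf.2 fun ζ' hζ' => by
        obtain ⟨ζ, hζ, rfl⟩ := Finset.mem_image.1 hζ'
        exact PartialNesting.mem_dom_comap.2 ((Finset.mem_filter.1 hζ).2 t)) z (by
      rw [hbz]
      refine (Finsupp.mem_supported ℤ _).2 fun τ hτ => PartialNesting.isNested_inf.2 ?_
      intro ζ' hζ'
      obtain ⟨ζ, hζ, rfl⟩ := Finset.mem_image.1 hζ'
      exact (Finsupp.mem_supported ℤ _).1 (hh.deform_mem (Finset.mem_filter.1 hζ).1 σ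
        (Finset.mem_filter.1 hζ).2 le_rfl hfaces) hτ)
    have hxS' : ∀ ζ ∈ S', (∀ t, σ t ∈ ζ.dom) → x ∈ (ζ.comap σ).nestedChain (n + 1) :=
      fun ζ hζ hσζ => Finsupp.supported_mono (fun τ hτ => PartialNesting.isNested_inf.1 hτ _
        (Finset.mem_image_of_mem _ (Finset.mem_filter.2 ⟨hζ, hσζ⟩))) hx
    have hbw : bdry (n + 1) (cone (n + 2) (bary (n + 1)) (n + 1) (z - x)) = z - x := by
      rw [bdry_cone, map_sub, hbx, sub_self, map_zero, sub_zero]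
    refine ⟨cone (n + 2) (bary (n + 1)) (n + 1) (z - x), fun ζ hζ => ⟨fun hσζ => ?_, fun hσζ => ?_⟩⟩
    · have hadj : ζ.adjoin (σ (bary (n + 1))) ∈ S' :=
        Finset.mem_union_right _ (Finset.mem_image.2
          ⟨(ζ, σ), Finset.mem_product.2 ⟨hζ, (hF (n + 1)).mem_toFinset.2 hσ⟩, rfl⟩)
      have hzx : z - x ∈ ((ζ.comap σ).adjoin (bary (n + 1))).nestedChain (n + 1) := by
        rw [PartialNesting.adjoin_comap]
        refine sub_mem (sub_mem ?_ ?_) (hxS' _ hadj hσζ.mem_bary)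
        · exact PartialNesting.single_mem_nestedChain
            (PartialNesting.isNested_comap.2 hσζ.adjoin_bary) 1
        · refine hh.transport_mem hadj σ le_rfl hfaces (bdry_mem_supported n
            (s := {ContinuousMap.id _}) ?_ (Finsupp.single_mem_supported ℤ _ rfl))
          rintro _ rfl i
          exact PartialNesting.isNested_comap.2 (hσζ.adjoin_bary.comp_simplexMap i.succAboveEmb)
      refine cone_mem_supported _ _ (fun τ hτ => ?_) hzx
      refine PartialNesting.IsNested.coneMap (A := Set.univ) le_rfl (starConvex_univ _)
        (fun q _ => ?_) (fun _ => Set.mem_univ _) hτ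
      rw [PartialNesting.adjoin_comap]
      exact PartialNesting.mem_dom_comap.2 (hσζ.mem_bary q)
    · have : fund (n + 1) - bdry (n + 1) (cone (n + 2) (bary (n + 1)) (n + 1) (z - x)) -
          transport (h n) σ (bdry n (fund (n + 1))) = x := by
        rw [hbw, hz]
        abel
      rw [this]
      exact hxS' ζ (hSS' ζ hζ) hσζ
  choose! w hw using hnew
  refine ⟨Function.update h (n + 1) w, fun m hm σ hσ ζ hζ => ?_⟩
  rcases Nat.lt_or_eq_of_le hm with hlt | rfl
  · rw [deform_congr (h' := h) σ fun k hk => Function.update_of_ne (by lia) _ _,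
      Function.update_of_ne hlt.ne]
    exact hh m (Nat.lt_succ_iff.1 hlt) σ hσ ζ (hSS' ζ hζ)
  · rw [deform_succ_apply, Function.update_self, Function.update_of_ne n.succ_ne_self.symm]
    have hid : transport w σ (fund (n + 1)) = w σ := by
      rw [fund, transport_single, push_id]
      rfl
    rw [hid]
    exact hw σ hσ ζ hζ

/-- Filling in the standard simplices only needs adapted operators on spaces in the lowest universe.
-/
theorem hasAdapted_and_fillsBoundaries (n : ℕ) : HasAdapted.{0} n ∧ FillsBoundaries n := by
  induction n with
  | zero => exact ⟨hasAdapted_zero, fillsBoundaries_of_hasAdapted hasAdapted_zero⟩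
  | succ n ih =>
    have h := hasAdapted_succ ih.1 ih.2
    exact ⟨h, fillsBoundaries_of_hasAdapted h⟩

theorem hasAdapted (n : ℕ) : HasAdapted.{u} n := by
  induction n with
  | zero => exact hasAdapted_zero
  | succ n ih => exact hasAdapted_succ ih (hasAdapted_and_fillsBoundaries n).2

/-! ### Passage to the chain complexes -/

section

variable {X : Type u} [TopologicalSpace X] (η : Nesting X)

/-- The inclusion of the nested chains into the singular chains, in one degree. -/
def nestedIncl (n : ℕ) : ((nestedSimplices η).obj n →₀ ℤ) →ₗ[ℤ] SChain X n :=
  Finsupp.lmapDomain ℤ ℤ Subtype.val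

theorem nestedIncl_single (n : ℕ) (σ : (nestedSimplices η).obj n) (a : ℤ) :
    nestedIncl η n (Finsupp.single σ a) = Finsupp.single σ.1 a :=
  Finsupp.mapDomain_single

theorem nestedIncl_injective (n : ℕ) : Function.Injective (nestedIncl η n) :=
  Finsupp.mapDomain_injective Subtype.val_injective

theorem bdry_nestedIncl (n : ℕ) (c : (nestedSimplices η).obj (n + 1) →₀ ℤ) :
    bdry n (nestedIncl η (n + 1) c) = nestedIncl η n ((nestedSimplices η).boundary n c) := by
  induction c using Finsupp.induction_linear with
  | zero => simp
  | add c d hc hd => simp only [map_add, hc, hd]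
  | single σ a =>
    rw [FaceSystem.boundary_single, nestedIncl_single, bdry_single, map_sum]
    refine Finset.sum_congr rfl fun i _ => ?_
    rw [map_smul, nestedIncl_single]
    rfl

theorem range_nestedIncl (n : ℕ) :
    LinearMap.range (nestedIncl η n) = η.toPartialNesting.nestedChain n := by
  have h := Finsupp.lmapDomain_supported ℤ ℤ
    (Subtype.val : {σ : C(StdSpx n, X) // η.IsNested σ} → C(StdSpx n, X)) Set.univ
  rw [Finsupp.supported_univ, Submodule.map_top, Set.image_univ] at h
  exact h.trans (congrArg (Finsupp.supported ℤ ℤ) Subtype.range_val)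

theorem Nesting.mem_dom (t : X) : t ∈ η.toPartialNesting.dom := by
  change t ∈ η.toOpens _
  rw [η.nil_eq_top]
  trivial

/-- If a nested chain is a boundary, it is the boundary of a nested chain. -/
theorem exists_nested_filling (n : ℕ) (d : SChain X (n + 1))
    (hd : bdry n d ∈ η.toPartialNesting.nestedChain n) :
    ∃ e ∈ η.toPartialNesting.nestedChain (n + 1), bdry n e = bdry n d := by
  obtain ⟨h, hh⟩ := hasAdapted (n + 1) X {η.toPartialNesting}
    (facesOf (d.support : Set C(StdSpx (n + 1), X))) (finite_facesOf d.support.finite_toSet)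
    (comp_succAbove_mem_facesOf _)
  have hdF : d ∈ Finsupp.supported ℤ ℤ (facesOf (d.support : Set C(StdSpx (n + 1), X)) (n + 1)) :=
    Finsupp.supported_mono (subset_facesOf _) (Finsupp.mem_supported_support ℤ d)
  refine ⟨transport (h n) (ContinuousMap.id _) (bdry n d) +
    deform h (ContinuousMap.id _) (n + 1) d, add_mem ?_ ?_, ?_⟩
  · exact hh.transport_mem (Finset.mem_singleton_self _) (ContinuousMap.id _) n.le_succ
      (bdry_mem_supported n (comp_succAbove_mem_facesOf _ n) hdF) hd
  · exact hh.deform_mem (Finset.mem_singleton_self _) (ContinuousMap.id _) (fun t => η.mem_dom t)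
      le_rfl hdF
  · rw [map_add, bdry_deform, deform_bdry, add_sub_cancel]

end

/-- The affine singular simplex of a face of `Δ^k`. -/
def affineFace (k n : ℕ) (τ : (simplexFaces k).obj n) : C(StdSpx n, StdSpx k) :=
  simplexMap (DFunLike.coe (F := Fin (n + 1) ↪o Fin (k + 1)) τ)

theorem affineFace_comp (k n : ℕ) (τ : (simplexFaces k).obj (n + 1)) (i : Fin (n + 2)) :
    (affineFace k (n + 1) τ).comp (simplexMap i.succAbove) =
      affineFace k n ((simplexFaces k).face i τ) :=
  simplexMap_comp _ _

/-- The embedding of the simplicial chains of `Δ^k` into the singular chains, in one degree. -/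
def simplicialIncl (k n : ℕ) : ((simplexFaces k).obj n →₀ ℤ) →ₗ[ℤ] SChain (StdSpx k) n :=
  Finsupp.lmapDomain ℤ ℤ (affineFace k n)

theorem simplicialIncl_single (k n : ℕ) (τ : (simplexFaces k).obj n) (a : ℤ) :
    simplicialIncl k n (Finsupp.single τ a) = Finsupp.single (affineFace k n τ) a :=
  Finsupp.mapDomain_single

theorem bdry_simplicialIncl (k n : ℕ) (c : (simplexFaces k).obj (n + 1) →₀ ℤ) :
    bdry n (simplicialIncl k (n + 1) c) =
      simplicialIncl k n ((simplexFaces k).boundary n c) := by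
  induction c using Finsupp.induction_linear with
  | zero => simp
  | add c d hc hd => simp only [map_add, hc, hd]
  | single σ a =>
    rw [FaceSystem.boundary_single, simplicialIncl_single, bdry_single, map_sum]
    refine Finset.sum_congr rfl fun i _ => ?_
    rw [map_smul, simplicialIncl_single, affineFace_comp]

theorem simplicialIncl_mem_supported (k n : ℕ) (c : (simplexFaces k).obj n →₀ ℤ) :
    simplicialIncl k n c ∈ Finsupp.supported ℤ ℤ
      (facesOf ({ContinuousMap.id _} : Set C(StdSpx k, StdSpx k)) n) := by
  refine map_mem_of_mem_supported _ _ (fun τ _ => ?_) (s := Set.univ)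
    (by simp [Finsupp.supported_univ])
  rw [simplicialIncl_single]
  exact Finsupp.single_mem_supported ℤ _ ⟨_, rfl, τ, ContinuousMap.id_comp _⟩

/-- On the faces of `Δ^k` there are adapted operators in all dimensions. -/
theorem exists_adapted_faces (k : ℕ) (ζ : PartialNesting (StdSpx k)) :
    ∃ h, ∀ n, Adapted {ζ} (facesOf ({ContinuousMap.id _} : Set C(StdSpx k, StdSpx k))) n h := by
  obtain ⟨h, hh⟩ := hasAdapted k (StdSpx k) {ζ}
    (facesOf ({ContinuousMap.id _} : Set C(StdSpx k, StdSpx k)))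
    (finite_facesOf (Set.finite_singleton _)) (comp_succAbove_mem_facesOf _)
  refine ⟨h, fun n m _ σ hσ => hh m ?_ σ hσ⟩
  obtain ⟨_, _, f, _⟩ := hσ
  have := Fintype.card_le_of_embedding f.toEmbedding
  simpa using this

theorem singularChains_d (X : Type u) [TopologicalSpace X] (n : ℕ) :
    (singularChains X).d (n + 1) n = ModuleCat.ofHom (bdry n) :=
  FaceSystem.chains_d _ n

theorem nestedChains_d {X : Type u} [TopologicalSpace X] (η : Nesting X) (n : ℕ) :
    (nestedChains η).d (n + 1) n = ModuleCat.ofHom ((nestedSimplices η).boundary n) :=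
  FaceSystem.chains_d _ n

theorem simplicialChains_d (k n : ℕ) :
    (simplicialChains k).d (n + 1) n = ModuleCat.ofHom ((simplexFaces k).boundary n) :=
  FaceSystem.chains_d _ n

/-- A family of linear maps in the degrees `n → n + 1` as a family of morphisms in all degrees. -/
def homOfSucc {C D : ChainComplex (ModuleCat.{u} ℤ) ℕ} (L : ∀ n, C.X n ⟶ D.X (n + 1)) (i j : ℕ) :
    C.X i ⟶ D.X j :=
  if hij : i + 1 = j then hij ▸ L i else 0

theorem homOfSucc_self {C D : ChainComplex (ModuleCat.{u} ℤ) ℕ} (L : ∀ n, C.X n ⟶ D.X (n + 1))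
    (i : ℕ) : homOfSucc L i (i + 1) = L i := dif_pos rfl

theorem exists_simplicial_deformation (k : ℕ) (η : Nesting (StdSpx k)) :
    ∃ (π : simplicialChains k ⟶ nestedChains η)
      (h : Homotopy (simplicialEmbedding k) (π ≫ nestedInclusion η)),
      ∀ (n : ℕ) (a : (simplicialChains k).X n),
        (simplicialEmbedding k).f n a ∈ Set.range ((nestedInclusion η).f n) →
          h.hom n (n + 1) a ∈ Set.range ((nestedInclusion η).f (n + 1)) := by
  obtain ⟨h, hh⟩ := exists_adapted_faces k η.toPartialNesting
  have hmem : ∀ n c, deform h (ContinuousMap.id _) n (simplicialIncl k n c) ∈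
      LinearMap.range (nestedIncl η n) := fun n c => by
    rw [range_nestedIncl]
    exact (hh n).deform_mem (Finset.mem_singleton_self _) (ContinuousMap.id _)
      (fun t => η.mem_dom t) le_rfl (simplicialIncl_mem_supported k n c)
  obtain ⟨P, hP⟩ : ∃ P : ∀ n, ((simplexFaces k).obj n →₀ ℤ) →ₗ[ℤ]
      ((nestedSimplices η).obj n →₀ ℤ), ∀ n c, nestedIncl η n (P n c) =
        deform h (ContinuousMap.id _) n (simplicialIncl k n c) :=
    ⟨fun n => (LinearEquiv.ofInjective _ (nestedIncl_injective η n)).symm.toLinearMap ∘ₗ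
      (deform h (ContinuousMap.id _) n ∘ₗ simplicialIncl k n).codRestrict _ (hmem n),
      fun n c => congrArg Subtype.val
        ((LinearEquiv.ofInjective _ (nestedIncl_injective η n)).apply_symm_apply _)⟩
  let π : simplicialChains k ⟶ nestedChains η :=
    ChainComplex.ofHom (X := simplicialChains k) (Y := nestedChains η)
      (fun n => ModuleCat.ofHom (P n)) (fun n => by
        rw [nestedChains_d, simplicialChains_d]
        change ModuleCat.ofHom _ ≫ ModuleCat.ofHom _ = ModuleCat.ofHom _ ≫ ModuleCat.ofHom _
        rw [← ModuleCat.ofHom_comp, ← ModuleCat.ofHom_comp]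
        congr 1
        refine LinearMap.ext fun c => nestedIncl_injective η n ?_
        rw [LinearMap.comp_apply, LinearMap.comp_apply, ← bdry_nestedIncl, hP, hP, bdry_deform,
          bdry_simplicialIncl])
  let L : ∀ n, (simplicialChains k).X n ⟶ (singularChains (StdSpx k)).X (n + 1) := fun n =>
    ModuleCat.ofHom (transport (h n) (ContinuousMap.id _) ∘ₗ simplicialIncl k n)
  refine ⟨π, ⟨homOfSucc L, fun i j hij => dif_neg hij, fun n => ?_⟩, fun n a ha => ?_⟩
  · cases n with
    | zero =>
      rw [Homotopy.dNext_zero_chainComplex, Homotopy.prevD_chainComplex, homOfSucc_self,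
        singularChains_d]
      refine ModuleCat.hom_ext (LinearMap.ext fun c : (simplexFaces k).obj 0 →₀ ℤ => ?_)
      change simplicialIncl k 0 c = 0 + bdry 0 (transport (h 0) (ContinuousMap.id _)
        (simplicialIncl k 0 c)) + nestedIncl η 0 (P 0 c)
      rw [hP, deform_zero_apply]
      abel
    | succ n =>
      rw [Homotopy.dNext_succ_chainComplex, Homotopy.prevD_chainComplex, homOfSucc_self,
        homOfSucc_self, singularChains_d, simplicialChains_d]
      refine ModuleCat.hom_ext (LinearMap.ext fun c : (simplexFaces k).obj (n + 1) →₀ ℤ => ?_)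
      change simplicialIncl k (n + 1) c =
        transport (h n) (ContinuousMap.id _) (simplicialIncl k n ((simplexFaces k).boundary n c)) +
          bdry (n + 1) (transport (h (n + 1)) (ContinuousMap.id _) (simplicialIncl k (n + 1) c)) +
            nestedIncl η (n + 1) (P (n + 1) c)
      rw [hP, deform_succ_apply, bdry_simplicialIncl]
      abel
  · change homOfSucc L n (n + 1) a ∈ _
    rw [homOfSucc_self]
    change simplicialIncl k n a ∈ LinearMap.range (nestedIncl η n) at ha
    change transport (h n) (ContinuousMap.id _) (simplicialIncl k n a) ∈
      LinearMap.range (nestedIncl η (n + 1))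
    rw [range_nestedIncl] at ha ⊢
    exact (hh n).transport_mem (Finset.mem_singleton_self _) (ContinuousMap.id _) le_rfl
      (simplicialIncl_mem_supported k n a) ha

end

theorem proposition2p1 :
    (∀ (k : ℕ) (η : Nesting (stdSimplex ℝ (Fin (k + 1)))),
      ∃ (π : simplicialChains k ⟶ nestedChains η)
        (h : Homotopy (simplicialEmbedding k) (π ≫ nestedInclusion η)),
        ∀ (n : ℕ) (a : (simplicialChains k).X n),
          (simplicialEmbedding k).f n a ∈ Set.range ((nestedInclusion η).f n) →
            h.hom n (n + 1) a ∈ Set.range ((nestedInclusion η).f (n + 1))) ∧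
    (∀ (X : Type u) [TopologicalSpace X] (η : Nesting X) (n : ℕ) (c : (nestedChains η).X n),
      (∃ d : (singularChains X).X (n + 1),
        (singularChains X).d (n + 1) n d = (nestedInclusion η).f n c) →
      ∃ e : (nestedChains η).X (n + 1), (nestedChains η).d (n + 1) n e = c) := by
  refine ⟨exists_simplicial_deformation, ?_⟩
  rintro X _ η n c ⟨d, hd⟩
  rw [singularChains_d] at hd
  change bdry n d = nestedIncl η n c at hd
  obtain ⟨e', he', hbe⟩ := exists_nested_filling η n d (by
    rw [hd, ← range_nestedIncl]
    exact LinearMap.mem_range_self _ _)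
  rw [← range_nestedIncl] at he'
  obtain ⟨e, rfl⟩ := he'
  refine ⟨e, ?_⟩
  rw [nestedChains_d]
  change (nestedSimplices η).boundary n e = c
  refine nestedIncl_injective η n ?_
  rw [← bdry_nestedIncl, hbe, hd]
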